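/- Let $k$ be a field and $n\ge 0$ an integer. For a set $A\subseteq\mathbb{Z}^n$ write $V_A$ for the $k$-vector space with basis $A$. Let $S,T\subseteq\mathbb{Z}^n$, write $S+T=\{P+Q : P\in S,\ Q\in T\}$, and for $p\ge 0$ let $$\delta:\bigwedge^p V_S\otimes V_T\longrightarrow\bigwedge^{p-1}V_S\otimes V_{S+T},\qquad P_1\wedge\dots\wedge P_p\otimes Q\longmapsto\sum_{i=1}^p(-1)^i\,P_1\wedge\dots\wedge\widehat{P_i}\wedge\dots\wedge P_p\otimes(Q+P_i),$$ for $P_1,\dots,P_p\in S$ and $Q\in T$, where the hat means that the factor is omitted, the sum $Q+P_i$ is taken in $\mathbb{Z}^n$, and $\bigwedge^{-1}$ of a vector space is zero. Let $\Delta,\Delta'\subseteq\mathbb{R}^n$ be convex lattice polytopes, that is, convex hulls of finite sets of points of $\mathbb{Z}^n$, and suppose that $\Delta$ has dimension greater than $1$. Put $T=\Delta\cap\mathbb{Z}^n$, $S=\Delta'\cap\mathbb{Z}^n$, $p=\#T-1$ and $X=\{P\in\mathbb{Z}^n : P+T\subseteq S\}$. Then $X$ is finite and $$\dim_k\ker\delta=\binom{p+\#X-1}{p}.$$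 -/

import Mathlib

open scoped Pointwise TensorProduct

noncomputable section

/-- The inclusion of the lattice `ℤⁿ` into `ℝⁿ`. -/
def latticeToReal {n : ℕ} (P : Fin n → ℤ) : Fin n → ℝ := fun i => (P i : ℝ)

/-- A convex lattice polytope in `ℝⁿ`: the convex hull of finitely many lattice points. -/
def IsLatticePolytope {n : ℕ} (Δ : Set (Fin n → ℝ)) : Prop :=
  ∃ V : Finset (Fin n → ℤ), Δ = convexHull ℝ (latticeToReal '' (V : Set (Fin n → ℤ)))

/-- The dimension of a subset of `ℝⁿ`: the dimension of its affine span. -/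
def polytopeDim {n : ℕ} (Δ : Set (Fin n → ℝ)) : ℕ := Module.finrank ℝ (vectorSpan ℝ Δ)

/-- The set `Δ ∩ ℤⁿ`. -/
def latticePoints {n : ℕ} (Δ : Set (Fin n → ℝ)) : Set (Fin n → ℤ) :=
  {P | latticeToReal P ∈ Δ}

/-- The set of `P ∈ ℤⁿ` with `P + T ⊆ S`. -/
def translatesInto {n : ℕ} (T S : Set (Fin n → ℤ)) : Set (Fin n → ℤ) :=
  {P | ∀ Q ∈ T, P + Q ∈ S}

section Koszul

section Bilinear

variable (k : Type*) [CommRing k] {V W U E : Type*} [AddCommGroup V] [Module k V]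
  [AddCommGroup W] [Module k W] [AddCommGroup U] [Module k U] [AddCommGroup E] [Module k E]
  (μ : V →ₗ[k] W →ₗ[k] U)

/-- For a bilinear map `μ : (v, w) ↦ v · w` and an alternating map `a` in `p` variables, the
linear map sending `v` to `(v₁, …, v_p) ↦ (w ↦ a(v₁, …, v_p) ⊗ (v · w))`, which is alternating in
`(v₁, …, v_p)`. -/
def koszulTerm {p : ℕ} (a : V [⋀^Fin p]→ₗ[k] E) : V →ₗ[k] V [⋀^Fin p]→ₗ[k] (W →ₗ[k] E ⊗[k] U) where
  toFun v := ((TensorProduct.mk k E U).compl₂ (μ v)).compAlternatingMap a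
  map_add' v v' := by
    ext; simp [TensorProduct.tmul_add]
  map_smul' c v := by
    ext; simp

/-- For a bilinear map `μ : (v, w) ↦ v · w` and an alternating map `a` in `p` variables, the
linear map `v₁ ∧ … ∧ v_{p+1} ⊗ w ↦ ∑ᵢ (-1)ⁱ a(v₁, …, v̂ᵢ, …, v_{p+1}) ⊗ (vᵢ · w)`,
with `i` from `1` to `p + 1`. -/
def koszulLift {p : ℕ} (a : V [⋀^Fin p]→ₗ[k] E) : (⋀[k]^(p + 1) V) ⊗[k] W →ₗ[k] E ⊗[k] U :=
  TensorProduct.lift (exteriorPower.alternatingMapLinearEquiv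
    (-AlternatingMap.alternatizeUncurryFin (koszulTerm k μ a)))

/-- The index `i` starts from `0` here, hence the sign `(-1)^(i+1)`. -/
theorem koszulLift_apply {p : ℕ} (a : V [⋀^Fin p]→ₗ[k] E) (v : Fin (p + 1) → V) (w : W) :
    koszulLift k μ a (exteriorPower.ιMulti k (p + 1) v ⊗ₜ[k] w) =
      ∑ i : Fin (p + 1), (-1 : k) ^ ((i : ℕ) + 1) •
        (a (fun j => v (i.succAbove j)) ⊗ₜ[k] μ (v i) w) := by
  simp only [koszulLift, TensorProduct.lift.tmul,
    exteriorPower.alternatingMapLinearEquiv_apply_ιMulti, AlternatingMap.neg_apply,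
    AlternatingMap.alternatizeUncurryFin_apply, LinearMap.neg_apply, LinearMap.sum_apply,
    ← Finset.sum_neg_distrib]
  refine Finset.sum_congr rfl fun i _ => ?_
  have h : koszulTerm k μ a (v i) (i.removeNth v) w =
      a (fun j => v (i.succAbove j)) ⊗ₜ[k] μ (v i) w := rfl
  rw [LinearMap.smul_apply, h]
  rcases Nat.even_or_odd (i : ℕ) with hi | hi <;> simp [hi.neg_one_pow, pow_succ]

/-- For a bilinear map `μ : (v, w) ↦ v · w`, the linear map `⋀ᵖ V ⊗ W → ⋀ᵖ⁻¹ V ⊗ U`,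
`v₁ ∧ … ∧ v_p ⊗ w ↦ ∑ᵢ (-1)ⁱ v₁ ∧ … ∧ v̂ᵢ ∧ … ∧ v_p ⊗ (vᵢ · w)`, with `i` from `1` to `p`.
For `p = 0` it is the zero map (with `⋀⁻¹ V = 0` the target would be zero; the kernel is all of
`⋀⁰ V ⊗ W` in either case). -/
def koszulDiff : (p : ℕ) → ((⋀[k]^p V) ⊗[k] W →ₗ[k] (⋀[k]^(p - 1) V) ⊗[k] U)
  | 0 => 0
  | p + 1 => koszulLift k μ (exteriorPower.ιMulti k p)

end Bilinear

variable (k : Type*) [Field k] {n : ℕ} (S T : Set (Fin n → ℤ))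

/-- The bilinear map `V_S × V_T → V_{S+T}` that sends a pair of basis vectors `(P, Q)` to the
basis vector `P + Q`. Here `V_S`, the vector space with basis `S`, is `S →₀ k`. -/
def addBilin : (S →₀ k) →ₗ[k] (T →₀ k) →ₗ[k] (↥(S + T) →₀ k) :=
  Finsupp.linearCombination k fun P : S =>
    Finsupp.lmapDomain k k fun Q : T =>
      (⟨(P : Fin n → ℤ) + Q, Set.add_mem_add P.2 Q.2⟩ : ↥(S + T))

theorem addBilin_single (P : S) (Q : T) :
    addBilin k S T (Finsupp.single P 1) (Finsupp.single Q 1) =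
      Finsupp.single (⟨(P : Fin n → ℤ) + Q, Set.add_mem_add P.2 Q.2⟩ : ↥(S + T)) (1 : k) := by
  simp [addBilin, Finsupp.mapDomain_single]

/-- The map `δ : ⋀ᵖ V_S ⊗ V_T → ⋀ᵖ⁻¹ V_S ⊗ V_{S+T}`,
`P₁ ∧ … ∧ P_p ⊗ Q ↦ ∑ᵢ (-1)ⁱ P₁ ∧ … ∧ P̂ᵢ ∧ … ∧ P_p ⊗ (Q + Pᵢ)`. -/
def koszulMap (p : ℕ) :
    (⋀[k]^p (S →₀ k)) ⊗[k] (T →₀ k) →ₗ[k] (⋀[k]^(p - 1) (S →₀ k)) ⊗[k] (↥(S + T) →₀ k) :=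
  koszulDiff k (addBilin k S T) p

/-- The defining formula of `δ` on basis vectors; the index `i` starts from `0` here, hence the
sign `(-1)^(i+1)`. -/
theorem koszulMap_single (p : ℕ) (P : Fin (p + 1) → S) (Q : T) :
    koszulMap k S T (p + 1)
        (exteriorPower.ιMulti k (p + 1) (fun j => Finsupp.single (P j) (1 : k)) ⊗ₜ[k]
          Finsupp.single Q (1 : k)) =
      ∑ i : Fin (p + 1), (-1 : k) ^ ((i : ℕ) + 1) •
        (exteriorPower.ιMulti k p (fun j => Finsupp.single (P (i.succAbove j)) (1 : k)) ⊗ₜ[k]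
          Finsupp.single (⟨(P i : Fin n → ℤ) + Q, Set.add_mem_add (P i).2 Q.2⟩ : ↥(S + T))
            (1 : k)) := by
  refine (koszulLift_apply k (addBilin k S T) (exteriorPower.ιMulti k p) _ _).trans ?_
  refine Finset.sum_congr rfl fun i _ => ?_
  rw [addBilin_single]

end Koszul

end

/-! ### Leading forms of group-ring elements with respect to a real weight -/

section LeadingForms

/-! Wedges become determinants: `P₁ ∧ … ∧ P_p` goes to `det (x_a ^ P_b)` in Laurent polynomials in
`p` groups of `n` variables. Applied for each `Q ∈ T`, this embeds `⋀ᵖ V_S ⊗ V_T` into tuples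
`(f_Q)` of alternating Laurent polynomials. Laplace expansion along one row turns `δ z = 0` into the
single equation `∑ x_0 ^ Q f_Q = 0` (`koszulMap_eq_zero_iff`); since the `f_Q` are alternating, the
equation then holds for every `x_i`.

This is a system of `p` equations in `p + 1 = #T` unknowns, so over the fraction field its solutions
are the multiples of the vector of signed maximal minors of `(x_i ^ t_l)`. The Laurent ring is a UFD
and these minors have no common factor except monomials, which are units
(`isMonomial_of_dvd_genMinor`; here `T` must not be collinear). Hence `f_Q = D_Q G` with a Laurent
polynomial `G`, which is symmetric because both `f_Q` and `D_Q` are alternating.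

An exponent `γ` of `G` must satisfy `γ_i + T ⊆ S`: otherwise a functional separating a point `γ_i +
t_m` from the polytope of `S` exhibits a forbidden monomial in some `D_l G`
(`mem_of_support_signedMinor_mul`). Conversely each symmetric `G` with exponents in `X` gives a
kernel element (`signedMinor_mul_mem_range`). So the kernel is isomorphic to the space of symmetric
Laurent polynomials with exponents in `X`, which has one dimension for each multiset of size `p` in
`X` (`rank_symmetricLaurent`).

The coprimality of the minors is proved by induction on their size: leading forms of a common
divisor divide leading forms of the minors, and these are smaller minors up to units. -/

theorem exists_mem_support_of_mem_support_sum {k Γ ι : Type*} [Field k] {s : Finset ι}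
    {f : ι → AddMonoidAlgebra k Γ} {γ : Γ} (h : γ ∈ (∑ i ∈ s, f i).coeff.support) :
    ∃ i ∈ s, γ ∈ (f i).coeff.support := by
  classical
  rw [AddMonoidAlgebra.coeff_sum] at h
  simpa using Finsupp.support_finsetSum h

variable {k Γ : Type*} [Field k] [AddCommGroup Γ]

/-- `g` is the part of `f` of weight `c`, and every other monomial of `f` has smaller weight. -/
structure IsLeadingForm (lam : Γ →+ ℝ) (c : ℝ) (f g : AddMonoidAlgebra k Γ) : Prop where
  weight_eq : ∀ γ ∈ g.coeff.support, lam γ = c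
  weight_lt : ∀ γ ∈ (f - g).coeff.support, lam γ < c

theorem exists_add_of_mem_support_mul {f g : AddMonoidAlgebra k Γ} {γ : Γ}
    (h : γ ∈ (f * g).coeff.support) :
    ∃ α ∈ f.coeff.support, ∃ β ∈ g.coeff.support, α + β = γ := by
  classical
  exact Finset.mem_add.1 (AddMonoidAlgebra.support_coeff_mul_subset f g h)

theorem mem_support_add {f g : AddMonoidAlgebra k Γ} {γ : Γ}
    (h : γ ∈ (f + g).coeff.support) : γ ∈ f.coeff.support ∨ γ ∈ g.coeff.support := by
  classical
  exact Finset.mem_union.1 (Finsupp.support_add h)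

theorem support_nonempty_of_ne_zero {f : AddMonoidAlgebra k Γ} (hf : f ≠ 0) :
    f.coeff.support.Nonempty := by
  rw [Finsupp.support_nonempty_iff]
  simpa using hf

namespace IsLeadingForm

variable {lam : Γ →+ ℝ} {c c' : ℝ} {f g f' g' : AddMonoidAlgebra k Γ}

theorem weight_le (h : IsLeadingForm lam c f g) {γ : Γ} (hγ : γ ∈ f.coeff.support) : lam γ ≤ c := by
  have : γ ∈ ((f - g) + g).coeff.support := by simpa using hγ
  rcases mem_support_add this with h1 | h1
  · exact (h.weight_lt γ h1).le
  · exact (h.weight_eq γ h1).le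

theorem coeff_eq (h : IsLeadingForm lam c f g) {γ : Γ} (hγ : lam γ = c) : f.coeff γ = g.coeff γ := by
  by_contra hne
  refine (h.weight_lt γ ?_).ne hγ
  rw [Finsupp.mem_support_iff]
  simpa [sub_eq_zero] using hne

theorem mem_support_left (h : IsLeadingForm lam c f g) {γ : Γ} (hγ : γ ∈ g.coeff.support) :
    γ ∈ f.coeff.support := by
  rw [Finsupp.mem_support_iff, h.coeff_eq (h.weight_eq γ hγ)]
  exact Finsupp.mem_support_iff.1 hγ

theorem mem_support_right (h : IsLeadingForm lam c f g) {γ : Γ} (hγ : γ ∈ f.coeff.support)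
    (hc : lam γ = c) : γ ∈ g.coeff.support := by
  rw [Finsupp.mem_support_iff, ← h.coeff_eq hc]
  exact Finsupp.mem_support_iff.1 hγ

theorem mul (h : IsLeadingForm lam c f g) (h' : IsLeadingForm lam c' f' g') :
    IsLeadingForm lam (c + c') (f * f') (g * g') where
  weight_eq γ hγ := by
    obtain ⟨α, hα, β, hβ, rfl⟩ := exists_add_of_mem_support_mul hγ
    rw [map_add, h.weight_eq α hα, h'.weight_eq β hβ]
  weight_lt γ hγ := by
    have e : f * f' - g * g' = (f - g) * f' + g * (f' - g') := by ring
    rw [e] at hγ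
    rcases mem_support_add hγ with h1 | h1
    · obtain ⟨α, hα, β, hβ, rfl⟩ := exists_add_of_mem_support_mul h1
      rw [map_add]
      exact add_lt_add_of_lt_of_le (h.weight_lt α hα) (h'.weight_le hβ)
    · obtain ⟨α, hα, β, hβ, rfl⟩ := exists_add_of_mem_support_mul h1
      rw [map_add]
      exact add_lt_add_of_le_of_lt (h.weight_eq α hα).le (h'.weight_lt β hβ)

theorem unique (h : IsLeadingForm lam c f g) (h' : IsLeadingForm lam c' f g') (hg : g ≠ 0)
    (hg' : g' ≠ 0) : c = c' ∧ g = g' := by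
  have hcc : c = c' := by
    obtain ⟨γ, hγ⟩ := support_nonempty_of_ne_zero hg
    obtain ⟨γ', hγ'⟩ := support_nonempty_of_ne_zero hg'
    apply le_antisymm
    · rw [← h.weight_eq γ hγ]
      exact h'.weight_le (h.mem_support_left hγ)
    · rw [← h'.weight_eq γ' hγ']
      exact h.weight_le (h'.mem_support_left hγ')
  subst hcc
  refine ⟨rfl, ?_⟩
  ext γ
  by_cases hc : lam γ = c
  · rw [← h.coeff_eq hc, h'.coeff_eq hc]
  · rw [Finsupp.notMem_support_iff.1 (fun hγ => hc (h.weight_eq γ hγ)),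
      Finsupp.notMem_support_iff.1 (fun hγ => hc (h'.weight_eq γ hγ))]

end IsLeadingForm

theorem exists_isLeadingForm (lam : Γ →+ ℝ) {f : AddMonoidAlgebra k Γ} (hf : f ≠ 0) :
    ∃ c g, g ≠ 0 ∧ IsLeadingForm lam c f g := by
  classical
  obtain ⟨γ₀, hγ₀, hmax⟩ := f.coeff.support.exists_max_image lam (support_nonempty_of_ne_zero hf)
  refine ⟨lam γ₀, .ofCoeff (f.coeff.filter fun γ => lam γ = lam γ₀), ?_, ?_, ?_⟩
  · intro h0
    have := congrArg (fun q : AddMonoidAlgebra k Γ => q.coeff γ₀) h0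
    simp only [Finsupp.filter_apply] at this
    exact Finsupp.mem_support_iff.1 hγ₀ (by simpa using this)
  · intro γ hγ
    simp only [Finsupp.support_filter, Finset.mem_filter] at hγ
    exact hγ.2
  · intro γ hγ
    rw [Finsupp.mem_support_iff, AddMonoidAlgebra.coeff_sub, Finsupp.sub_apply,
      AddMonoidAlgebra.coeff_ofCoeff, Finsupp.filter_apply] at hγ
    by_cases hc : lam γ = lam γ₀
    · simp [hc] at hγ
    · rw [if_neg hc, sub_zero] at hγ
      exact lt_of_le_of_ne (hmax γ (Finsupp.mem_support_iff.2 hγ)) hc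

variable [IsDomain (AddMonoidAlgebra k Γ)]

/-- In a domain leading forms are multiplicative, so the leading form of the quotient witnesses the
divisibility. -/
theorem IsLeadingForm.dvd {lam : Γ →+ ℝ} {c c' : ℝ} {f g f' g' : AddMonoidAlgebra k Γ}
    (h : IsLeadingForm lam c f g) (h' : IsLeadingForm lam c' f' g') (hg : g ≠ 0) (hg' : g' ≠ 0)
    (hdvd : f ∣ f') : g ∣ g' := by
  obtain ⟨q, rfl⟩ := hdvd
  have hq : q ≠ 0 := by
    rintro rfl
    obtain ⟨γ, hγ⟩ := support_nonempty_of_ne_zero hg'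
    have := h'.mem_support_left hγ
    simp at this
  obtain ⟨d, r, hr, hqr⟩ := exists_isLeadingForm lam hq
  exact ⟨r, ((h.mul hqr).unique h' (mul_ne_zero hg hr) hg').2.symm⟩

/-- The product of the two leading forms is nonzero, so the top weight of a product is the sum of
the top weights. -/
theorem exists_mem_support_mul_weight_ge (lam : Γ →+ ℝ) {f g : AddMonoidAlgebra k Γ} {α β : Γ}
    (hα : α ∈ f.coeff.support) (hβ : β ∈ g.coeff.support) :
    ∃ γ ∈ (f * g).coeff.support, lam α + lam β ≤ lam γ := by
  have hf : f ≠ 0 := by rintro rfl; simp at hα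
  have hg : g ≠ 0 := by rintro rfl; simp at hβ
  obtain ⟨c, f', hf', h1⟩ := exists_isLeadingForm lam hf
  obtain ⟨d, g', hg', h2⟩ := exists_isLeadingForm lam hg
  obtain ⟨γ, hγ⟩ := support_nonempty_of_ne_zero (mul_ne_zero hf' hg')
  refine ⟨γ, (h1.mul h2).mem_support_left hγ, ?_⟩
  rw [(h1.mul h2).weight_eq γ hγ]
  exact add_le_add (h1.weight_le hα) (h2.weight_le hβ)

/-- A divisor of a homogeneous element is homogeneous. -/
theorem weight_eq_of_mul_homogeneous {lam : Γ →+ ℝ} {f g : AddMonoidAlgebra k Γ} {c : ℝ}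
    (hg : g ≠ 0) (h : ∀ γ ∈ (f * g).coeff.support, lam γ = c) {α α' : Γ}
    (hα : α ∈ f.coeff.support) (hα' : α' ∈ f.coeff.support) : lam α = lam α' := by
  obtain ⟨β, hβ⟩ := support_nonempty_of_ne_zero hg
  -- Comparing top weights for `lam` and for `-lam` shows that a spread of weights in `f` would
  -- persist in `f * g`.
  have key : ∀ {x y : Γ}, x ∈ f.coeff.support → y ∈ f.coeff.support → lam x ≤ lam y := by
    intro x y hx hy
    obtain ⟨γ, hγ, h1⟩ := exists_mem_support_mul_weight_ge lam hx hβ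
    obtain ⟨γ', hγ', h2⟩ := exists_mem_support_mul_weight_ge (-lam) hy hβ
    rw [h γ hγ] at h1
    simp only [AddMonoidHom.neg_apply, h γ' hγ'] at h2
    linarith
  exact le_antisymm (key hα hα') (key hα' hα)

/-- If `γ` is a monomial of `f * g` of largest weight and the leading form of `f` is a monomial
`x`, then `x` occurs in each decomposition of `γ`. -/
theorem eq_of_add_mem_support_mul {lam : Γ →+ ℝ} {f g : AddMonoidAlgebra k Γ} {c : ℝ} {b : k}
    {x α β : Γ} (h : IsLeadingForm lam c f (.single x b)) (hb : b ≠ 0) (hα : α ∈ f.coeff.support)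
    (hβ : β ∈ g.coeff.support) (hmax : ∀ γ ∈ (f * g).coeff.support, lam γ ≤ lam (α + β)) :
    α = x := by
  have hx : x ∈ (AddMonoidAlgebra.single x b).coeff.support := by simp [hb]
  obtain ⟨γ, hγ, h1⟩ := exists_mem_support_mul_weight_ge lam (h.mem_support_left hx) hβ
  have h2 := hmax γ hγ
  rw [map_add] at h2
  have h3 := h.weight_le hα
  rw [h.weight_eq x hx] at h1
  have h4 := h.mem_support_right hα (by linarith)
  simpa using Finsupp.support_single_subset h4

/-- One monomial `γ` of `D` is extremal for both weights. In a decomposition `γ = α + β` along `D =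
f * g`, the same `α` is forced to be `x` by `lam` and `y` by `mu`. -/
theorem leading_monomials_eq {lam mu : Γ →+ ℝ} {f D : AddMonoidAlgebra k Γ} {c c' : ℝ} {b b' : k}
    {x y γ : Γ} (hD : f ∣ D) (h : IsLeadingForm lam c f (.single x b)) (hb : b ≠ 0)
    (h' : IsLeadingForm mu c' f (.single y b')) (hb' : b' ≠ 0) (hγ : γ ∈ D.coeff.support)
    (hmax : ∀ γ' ∈ D.coeff.support, lam γ' ≤ lam γ)
    (hmax' : ∀ γ' ∈ D.coeff.support, mu γ' ≤ mu γ) : x = y := by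
  obtain ⟨g, rfl⟩ := hD
  obtain ⟨α, hα, β, hβ, rfl⟩ := exists_add_of_mem_support_mul hγ
  rw [← eq_of_add_mem_support_mul h hb hα hβ hmax, eq_of_add_mem_support_mul h' hb' hα hβ hmax']

end LeadingForms

/-! ### Generalized Vandermonde minors and their leading forms -/

section Minors

/-- The weight `γ ↦ w (γ i)`. -/
noncomputable def weightAt {I : Type*} {n : ℕ} (i : I) (w : Module.Dual ℝ (Fin n → ℝ)) :
    (I → Fin n → ℤ) →+ ℝ where
  toFun γ := w (latticeToReal (γ i))
  map_zero' := by
    have : latticeToReal (0 : Fin n → ℤ) = 0 := by ext; simp [latticeToReal]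
    simp [this]
  map_add' γ γ' := by
    have : latticeToReal (γ i + γ' i) = latticeToReal (γ i) + latticeToReal (γ' i) := by
      ext; simp [latticeToReal]
    simp [this]

theorem weightAt_apply {I : Type*} {n : ℕ} (i : I) (w : Module.Dual ℝ (Fin n → ℝ))
    (γ : I → Fin n → ℤ) :
    weightAt i w γ = w (latticeToReal (γ i)) := rfl

variable (k : Type*) [Field k] {I : Type*} [DecidableEq I] {n : ℕ}

/-- The monomial `x_i ^ P` in the variables `(x_i)_{i ∈ I}` with exponents in `ℤⁿ`. -/
noncomputable def monomialAt (i : I) (P : Fin n → ℤ) : AddMonoidAlgebra k (I → Fin n → ℤ) :=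
  .single (Pi.single i P) 1

/-- The determinant of the monomials `x_{e a} ^ (t l)`. -/
noncomputable def genMinor {r : ℕ} (e : Fin r → I) (t : Fin r → Fin n → ℤ) :
    AddMonoidAlgebra k (I → Fin n → ℤ) :=
  Matrix.det (Matrix.of fun a l => monomialAt k (e a) (t l))

/-- The exponent of `∏ₐ x_{e a} ^ (u a)`. -/
def exponentOf {r : ℕ} (e : Fin r → I) (u : Fin r → Fin n → ℤ) : I → Fin n → ℤ :=
  ∑ a, Pi.single (e a) (u a)

theorem prod_monomialAt {ι : Type*} (s : Finset ι) (e : ι → I) (u : ι → Fin n → ℤ) :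
    ∏ a ∈ s, monomialAt k (e a) (u a) = .single (∑ a ∈ s, Pi.single (e a) (u a)) 1 := by
  classical
  induction s using Finset.induction_on with
  | empty => rfl
  | insert a s ha ih =>
    rw [Finset.prod_insert ha, Finset.sum_insert ha, ih, monomialAt,
      AddMonoidAlgebra.single_mul_single, one_mul]

variable {r : ℕ} {e : Fin r → I}

theorem exponentOf_apply (he : Function.Injective e) (u : Fin r → Fin n → ℤ) (a : Fin r) :
    exponentOf e u (e a) = u a := by
  rw [exponentOf, Finset.sum_apply, Finset.sum_eq_single a]
  · simp
  · intro b _ hb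
    exact Pi.single_eq_of_ne (fun h => hb (he h).symm) _
  · simp

theorem exponentOf_apply_of_ne (u : Fin r → Fin n → ℤ) {i : I} (hi : ∀ a, e a ≠ i) :
    exponentOf e u i = 0 := by
  rw [exponentOf, Finset.sum_apply]
  exact Finset.sum_eq_zero fun a _ => Pi.single_eq_of_ne (hi a).symm _

theorem genMinor_eq_sum (e : Fin r → I) (t : Fin r → Fin n → ℤ) :
    genMinor k e t = ∑ σ : Equiv.Perm (Fin r),
      Equiv.Perm.sign σ • AddMonoidAlgebra.single (exponentOf e (t ∘ σ)) (1 : k) := by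
  rw [genMinor, ← Matrix.det_transpose, Matrix.det_apply]
  refine Finset.sum_congr rfl fun σ _ => ?_
  simp only [Matrix.transpose_apply, Matrix.of_apply]
  rw [prod_monomialAt]
  rfl

variable {k} {t : Fin r → Fin n → ℤ}

theorem exists_perm_of_mem_support_genMinor {γ : I → Fin n → ℤ}
    (h : γ ∈ (genMinor k e t).coeff.support) :
    ∃ σ : Equiv.Perm (Fin r), γ = exponentOf e (t ∘ σ) := by
  rw [genMinor_eq_sum] at h
  obtain ⟨σ, _, hσ⟩ := exists_mem_support_of_mem_support_sum h
  refine ⟨σ, ?_⟩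
  have h2 := Finsupp.support_smul hσ
  simpa using h2

/-- Distinct permutations give distinct exponents, so no terms of the determinant cancel, in any
characteristic. -/
theorem coeff_genMinor (he : Function.Injective e) (ht : Function.Injective t)
    (σ : Equiv.Perm (Fin r)) :
    (genMinor k e t).coeff (exponentOf e (t ∘ σ)) = ((Equiv.Perm.sign σ : ℤ) : k) := by
  rw [genMinor_eq_sum, AddMonoidAlgebra.coeff_sum, Finsupp.finsetSum_apply,
    Finset.sum_eq_single σ]
  · rcases Int.units_eq_one_or (Equiv.Perm.sign σ) with h | h <;> simp [h]
  · intro τ _ hτ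
    have : exponentOf e (t ∘ σ) ≠ exponentOf e (t ∘ τ) := by
      intro h
      refine hτ (Equiv.ext fun a => ?_)
      have := congrFun h (e a)
      rw [exponentOf_apply he, exponentOf_apply he] at this
      exact (ht this).symm
    rcases Int.units_eq_one_or (Equiv.Perm.sign τ) with h | h <;> simp [h, this.symm]
  · simp

theorem exponentOf_mem_support_genMinor (he : Function.Injective e) (ht : Function.Injective t)
    (σ : Equiv.Perm (Fin r)) : exponentOf e (t ∘ σ) ∈ (genMinor k e t).coeff.support := by
  rw [Finsupp.mem_support_iff, coeff_genMinor he ht]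
  rcases Int.units_eq_one_or (Equiv.Perm.sign σ) with h | h <;> simp [h]

theorem genMinor_ne_zero (he : Function.Injective e) (ht : Function.Injective t) :
    genMinor k e t ≠ 0 := by
  intro h
  have := exponentOf_mem_support_genMinor (k := k) he ht 1
  simp [h] at this

theorem apply_eq_zero_of_mem_support_genMinor {γ : I → Fin n → ℤ}
    (h : γ ∈ (genMinor k e t).coeff.support) {i : I} (hi : ∀ a, e a ≠ i) : γ i = 0 := by
  obtain ⟨σ, rfl⟩ := exists_perm_of_mem_support_genMinor h
  exact exponentOf_apply_of_ne _ hi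

theorem exists_apply_eq_of_mem_support_genMinor (he : Function.Injective e) {γ : I → Fin n → ℤ}
    (h : γ ∈ (genMinor k e t).coeff.support) (a : Fin r) : ∃ l, γ (e a) = t l := by
  obtain ⟨σ, rfl⟩ := exists_perm_of_mem_support_genMinor h
  exact ⟨σ a, exponentOf_apply he _ _⟩

theorem isUnit_monomialAt (i : I) (P : Fin n → ℤ) : IsUnit (monomialAt k i P) := by
  refine IsUnit.of_mul_eq_one (monomialAt k i (-P)) ?_
  rw [monomialAt, monomialAt, AddMonoidAlgebra.single_mul_single, ← Pi.single_add]
  simp [AddMonoidAlgebra.one_def]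

theorem genMinor_succ (e : Fin (r + 1) → I) (t : Fin (r + 1) → Fin n → ℤ) (a : Fin (r + 1)) :
    genMinor k e t = ∑ l : Fin (r + 1), (-1) ^ (a + l : ℕ) * monomialAt k (e a) (t l) *
      genMinor k (e ∘ a.succAbove) (t ∘ l.succAbove) := by
  rw [genMinor, Matrix.det_succ_row _ a]
  rfl

/-- If `w` has a strict maximum on the exponents `t` at `m`, then the leading form of the minor
with respect to `w` in the variable `x_{e a}` is the corresponding term of the expansion. -/
theorem isLeadingForm_genMinor {e : Fin (r + 1) → I} (he : Function.Injective e)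
    {t : Fin (r + 1) → Fin n → ℤ} (a m : Fin (r + 1)) (w : Module.Dual ℝ (Fin n → ℝ))
    (hw : ∀ l, l ≠ m → w (latticeToReal (t l)) < w (latticeToReal (t m))) :
    IsLeadingForm (weightAt (e a) w) (w (latticeToReal (t m))) (genMinor k e t)
      ((-1) ^ (a + m : ℕ) * monomialAt k (e a) (t m) *
        genMinor k (e ∘ a.succAbove) (t ∘ m.succAbove)) := by
  have key : ∀ l : Fin (r + 1), ∀ γ ∈ ((-1) ^ (a + l : ℕ) * monomialAt k (e a) (t l) *
      genMinor k (e ∘ a.succAbove) (t ∘ l.succAbove)).coeff.support,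
      weightAt (e a) w γ = w (latticeToReal (t l)) := by
    intro l γ hγ
    have h1 : γ ∈ (monomialAt k (e a) (t l) *
        genMinor k (e ∘ a.succAbove) (t ∘ l.succAbove)).coeff.support := by
      rcases neg_one_pow_eq_or (AddMonoidAlgebra k (I → Fin n → ℤ)) (a + l : ℕ) with h | h <;>
        rw [h] at hγ
      · simpa using hγ
      · rw [Finsupp.mem_support_iff] at hγ ⊢
        simpa using hγ
    obtain ⟨α, hα, β, hβ, rfl⟩ := exists_add_of_mem_support_mul h1
    have h2 : α = Pi.single (e a) (t l) := by
      simpa using Finsupp.support_single_subset hα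
    have h3 : β (e a) = 0 :=
      apply_eq_zero_of_mem_support_genMinor hβ fun b h => (a.succAbove_ne b) (he h)
    rw [weightAt_apply, Pi.add_apply, h3, h2, Pi.single_eq_same, add_zero]
  refine ⟨key m, fun γ hγ => ?_⟩
  rw [genMinor_succ e t a, ← Finset.sum_erase_eq_sub (Finset.mem_univ m)] at hγ
  obtain ⟨l, hl, hlγ⟩ := exists_mem_support_of_mem_support_sum hγ
  rw [key l γ hlγ]
  exact hw l (Finset.ne_of_mem_erase hl)

end Minors

/-! ### Functionals with unique extremes on a non-collinear family -/

section Coprime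

variable {E : Type*} [AddCommGroup E] [Module ℝ E]

theorem exists_dual_eq_one_of_notMem_span {v u : E} (h : v ∉ Submodule.span ℝ {u}) :
    ∃ w : Module.Dual ℝ E, w v = 1 ∧ w u = 0 := by
  obtain ⟨f, hf, hfu⟩ := Submodule.exists_dual_map_eq_bot_of_notMem h inferInstance
  refine ⟨(f v)⁻¹ • f, by simp [hf], ?_⟩
  have : f u ∈ (Submodule.span ℝ {u}).map f :=
    Submodule.mem_map_of_mem (Submodule.mem_span_singleton_self u)
  rw [hfu, Submodule.mem_bot] at this
  simp [this]

/-- A family with a strict maximum at `m` and a strict minimum at `m'`. -/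
def HasExtremes {ι : Type*} (f : ι → ℝ) (m m' : ι) : Prop :=
  (∀ l, l ≠ m → f l < f m) ∧ ∀ l, l ≠ m' → f m' < f l

theorem exists_hasExtremes_of_injective {ι : Type*} [Finite ι] [Nonempty ι] {f : ι → ℝ}
    (hf : Function.Injective f) : ∃ m m', HasExtremes f m m' := by
  obtain ⟨m, hm⟩ := Finite.exists_max f
  obtain ⟨m', hm'⟩ := Finite.exists_min f
  exact ⟨m, m', fun l hl => lt_of_le_of_ne (hm l) (hf.ne hl),
    fun l hl => lt_of_le_of_ne (hm' l) (hf.ne hl.symm)⟩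

theorem exists_dual_injective_comp {ι : Type*} [Finite ι] {x : ι → E}
    (hx : Function.Injective x) : ∃ w : Module.Dual ℝ E, Function.Injective (w ∘ x) := by
  obtain ⟨w, hw⟩ := Module.exists_dual_forall_apply_ne_zero (K := ℝ)
    (fun q : {q : ι × ι // q.1 ≠ q.2} => x q.1.1 - x q.1.2)
    (fun q => sub_ne_zero.2 (hx.ne q.2))
  refine ⟨w, fun i j hij => ?_⟩
  by_contra hne
  exact hw ⟨(i, j), hne⟩ (by simpa [sub_eq_zero] using hij)

theorem range_eq_insert_succAbove {ι : Type*} {r : ℕ} (x : Fin (r + 1) → ι) (q : Fin (r + 1)) :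
    Set.range x = insert (x q) (Set.range (x ∘ q.succAbove)) := by
  rw [Set.range_comp, Fin.range_succAbove, ← Set.image_insert_eq, Set.insert_eq,
    Set.union_compl_self, Set.image_univ]

/-- A non-collinear family of at least four points has a linear functional with a unique maximum
and a unique minimum each of which can be removed leaving a non-collinear family. -/
theorem exists_dual_hasExtremes {r : ℕ} (hr : 3 ≤ r) {x : Fin (r + 1) → E}
    (hx : Function.Injective x) (hc : ¬ Collinear ℝ (Set.range x)) :
    ∃ (w : Module.Dual ℝ E) (m m' : Fin (r + 1)), HasExtremes (w ∘ x) m m' ∧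
      ¬ Collinear ℝ (Set.range (x ∘ m.succAbove)) ∧
      ¬ Collinear ℝ (Set.range (x ∘ m'.succAbove)) := by
  -- If every deletion stays non-collinear, any functional injective on the family works. Otherwise
  -- all points but `x q` lie on a line, and the functional has to be chosen so that `x q` is not
  -- extreme.
  by_cases hq : ∃ q : Fin (r + 1), Collinear ℝ (Set.range (x ∘ q.succAbove))
  swap
  · push Not at hq
    obtain ⟨w, hw⟩ := exists_dual_injective_comp hx
    obtain ⟨m, m', h⟩ := exists_hasExtremes_of_injective hw
    exact ⟨w, m, m', h, hq _, hq _⟩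
  obtain ⟨q, hq⟩ := hq
  obtain ⟨p₀, v, hv⟩ := (collinear_iff_exists_forall_eq_smul_vadd (k := ℝ) _).1 hq
  have hv' : ∀ l : Fin r, ∃ s : ℝ, x (q.succAbove l) = s • v + p₀ := fun l =>
    hv _ ⟨l, rfl⟩
  choose s hs using hv'
  have hsinj : Function.Injective s := fun i j hij =>
    Fin.succAbove_right_injective (hx (by rw [hs, hs, hij]))
  have : Nonempty (Fin r) := ⟨⟨0, by omega⟩⟩
  obtain ⟨m, m', hm, hm'⟩ := exists_hasExtremes_of_injective hsinj
  have hmm : m ≠ m' := by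
    rintro rfl
    obtain ⟨l, hl⟩ : ∃ l : Fin r, l ≠ m := by
      have : Nontrivial (Fin r) := Fin.nontrivial_iff_two_le.2 (by omega)
      exact exists_ne m
    exact lt_asymm (hm l hl) (hm' l hl)
  -- A point strictly between the two ends of the line; it exists because `r ≥ 3`.
  obtain ⟨c, hcm, hcm'⟩ : ∃ c : Fin r, c ≠ m ∧ c ≠ m' := by
    have : ({m, m'} : Finset (Fin r)).card < Fintype.card (Fin r) := by
      rw [Fintype.card_fin]
      exact Finset.card_le_two.trans_lt (by omega)
    obtain ⟨c, hc⟩ := Finset.exists_mem_notMem_of_card_lt_card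
      (this.trans_eq (Finset.card_univ).symm)
    exact ⟨c, by simpa using hc⟩
  have hline : ∀ i j : Fin r, i ≠ j →
      ¬ Collinear ℝ {x q, x (q.succAbove i), x (q.succAbove j)} := by
    intro i j hij h
    apply hc
    rw [range_eq_insert_succAbove x q]
    exact (hq.collinear_insert_iff_of_ne (p₂ := x (q.succAbove i)) (p₃ := x (q.succAbove j))
      ⟨i, rfl⟩ ⟨j, rfl⟩ (hx.ne (Fin.succAbove_right_injective.ne hij))).2 h
  have hrem : ∀ a i j : Fin r, i ≠ j → i ≠ a → j ≠ a →
      ¬ Collinear ℝ (Set.range (x ∘ (q.succAbove a).succAbove)) := by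
    intro a i j hij hia hja h
    refine hline i j hij (h.subset ?_)
    have hmem : ∀ y, y ≠ q.succAbove a →
        x y ∈ Set.range (x ∘ (q.succAbove a).succAbove) := by
      intro y hy
      obtain ⟨z, hz⟩ := Fin.exists_succAbove_eq hy
      exact ⟨z, by simp [hz]⟩
    rintro y (rfl | rfl | rfl)
    · exact hmem _ (q.succAbove_ne a).symm
    · exact hmem _ (Fin.succAbove_right_injective.ne hia)
    · exact hmem _ (Fin.succAbove_right_injective.ne hja)
  -- This allows a functional equal to `1` on the direction `v` and equal at `x q` and at the
  -- intermediate point `c`. It then orders the line by `s` and keeps `x q` strictly between the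
  -- extremes.
  have hspan : v ∉ Submodule.span ℝ {x q - x (q.succAbove c)} := by
    intro hmem
    obtain ⟨b, hb⟩ := Submodule.mem_span_singleton.1 hmem
    refine hline m c hcm.symm ?_
    rw [collinear_iff_of_mem (p₀ := x (q.succAbove c)) (by simp)]
    refine ⟨x q - x (q.succAbove c), ?_⟩
    rintro y (rfl | rfl | rfl)
    · exact ⟨1, by simp⟩
    · refine ⟨(s m - s c) * b, ?_⟩
      rw [mul_smul, hb, hs, hs, vadd_eq_add]
      module
    · exact ⟨0, by simp⟩
  obtain ⟨w, hwv, hwu⟩ := exists_dual_eq_one_of_notMem_span hspan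
  have hw : ∀ l, w (x (q.succAbove l)) = s l + w p₀ := by
    intro l
    rw [hs, map_add, map_smul, hwv, smul_eq_mul, mul_one]
  have hwq : w (x q) = s c + w p₀ := by
    rw [← hw, ← sub_eq_zero, ← map_sub, hwu]
  refine ⟨w, q.succAbove m, q.succAbove m', ⟨?_, ?_⟩, hrem m c m' hcm' hcm hmm.symm,
    hrem m' c m hcm hcm' hmm⟩
  · intro l hl
    rcases Fin.eq_self_or_eq_succAbove q l with rfl | ⟨l, rfl⟩
    · simpa [hw, hwq] using hm c hcm
    · simpa [hw] using hm l (fun h => hl (by rw [h]))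
  · intro l hl
    rcases Fin.eq_self_or_eq_succAbove q l with rfl | ⟨l, rfl⟩
    · simpa [hw, hwq] using hm' c hcm'
    · simpa [hw] using hm' l (fun h => hl (by rw [h]))

end Coprime

/-! ### Coprimality of the maximal minors up to monomials -/

section Coprime

variable {k : Type*} [Field k] {I : Type*} {n : ℕ}

theorem latticeToReal_injective : Function.Injective (latticeToReal (n := n)) := by
  intro P Q h
  ext i
  have := congrFun h i
  simpa [latticeToReal] using this

/-- The weight given by a linear functional on the real exponents. -/
noncomputable def dualWeight (L : Module.Dual ℝ (I → Fin n → ℝ)) : (I → Fin n → ℤ) →+ ℝ where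
  toFun γ := L fun i => latticeToReal (γ i)
  map_zero' := by
    have : (fun i => latticeToReal ((0 : I → Fin n → ℤ) i)) = 0 := by ext; simp [latticeToReal]
    rw [this, map_zero]
  map_add' γ γ' := by
    rw [← map_add]
    congr 1
    ext
    simp [latticeToReal]

/-- If the monomials of `D` lie on a line, then so do those of each divisor. -/
theorem exists_smul_of_dvd [Finite I] {H D : AddMonoidAlgebra k (I → Fin n → ℤ)}
    {γ₀ γ₁ : I → Fin n → ℤ} (hD : D ≠ 0) (hdvd : H ∣ D)
    (hsupp : ∀ γ ∈ D.coeff.support, γ = γ₀ ∨ γ = γ₁) {α β : I → Fin n → ℤ}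
    (hα : α ∈ H.coeff.support) (hβ : β ∈ H.coeff.support) :
    ∃ s : ℝ, ∀ i, latticeToReal (α i) - latticeToReal (β i) =
      s • (latticeToReal (γ₁ i) - latticeToReal (γ₀ i)) := by
  obtain ⟨C, rfl⟩ := hdvd
  set u : I → Fin n → ℝ := fun i => latticeToReal (γ₁ i) - latticeToReal (γ₀ i) with hu
  set v : I → Fin n → ℝ := fun i => latticeToReal (α i) - latticeToReal (β i) with hv
  -- A functional that kills `u` but not `v` would make the product homogeneous and its divisor
  -- inhomogeneous.
  have hmem : v ∈ Submodule.span ℝ {u} := by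
    by_contra hnot
    obtain ⟨L, hLv, hLu⟩ := exists_dual_eq_one_of_notMem_span hnot
    have h0 : dualWeight L γ₁ = dualWeight L γ₀ := by
      rw [← sub_eq_zero]
      refine Eq.trans ?_ hLu
      exact (map_sub L _ _).symm
    have h1 := weight_eq_of_mul_homogeneous (lam := dualWeight L) (c := dualWeight L γ₀)
      (right_ne_zero_of_mul hD)
      (fun γ hγ => by rcases hsupp γ hγ with rfl | rfl; exacts [rfl, h0]) hα hβ
    rw [← sub_eq_zero] at h1
    have h2 : L v = 0 := Eq.trans (map_sub L _ _) h1
    rw [hLv] at h2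
    exact one_ne_zero h2
  obtain ⟨s, hs⟩ := Submodule.mem_span_singleton.1 hmem
  exact ⟨s, fun i => (congrFun hs i).symm⟩

theorem isMonomial_of_subsingleton_support {Γ : Type*} [AddCommGroup Γ]
    {H : AddMonoidAlgebra k Γ}
    (hH : H ≠ 0) (h : ∀ α ∈ H.coeff.support, ∀ β ∈ H.coeff.support, α = β) :
    ∃ x b, b ≠ 0 ∧ H = .single x b := by
  obtain ⟨x, hx⟩ := support_nonempty_of_ne_zero hH
  refine ⟨x, H.coeff x, Finsupp.mem_support_iff.1 hx, ?_⟩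
  ext γ
  by_cases hγ : γ ∈ H.coeff.support
  · rw [h γ hγ x hx]
    simp
  · have hne : x ≠ γ := fun h => hγ (h ▸ hx)
    rw [Finsupp.notMem_support_iff.1 hγ]
    simp [hne]

variable [DecidableEq I]

theorem support_genMinor_fin_two {e : Fin 2 → I} {t : Fin 2 → Fin n → ℤ} {γ : I → Fin n → ℤ}
    (h : γ ∈ (genMinor k e t).coeff.support) :
    γ = exponentOf e t ∨ γ = exponentOf e (t ∘ Equiv.swap 0 1) := by
  obtain ⟨σ, rfl⟩ := exists_perm_of_mem_support_genMinor h
  have : ∀ σ : Equiv.Perm (Fin 2), σ = 1 ∨ σ = Equiv.swap 0 1 := by decide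
  rcases this σ with rfl | rfl
  · exact Or.inl rfl
  · exact Or.inr rfl

/-- A two-rowed minor is a binomial, so differences of exponents of `H` are parallel to its segment.
In the variable `x_{e 0}` two of these segments have the directions `t 1 - t 0` and `t 2 - t 1`,
which are independent. -/
theorem isMonomial_of_dvd_genMinor_two [Finite I] {e : Fin 2 → I} (he : Function.Injective e)
    {t : Fin 3 → Fin n → ℤ} (ht : Function.Injective t)
    (hc : ¬ Collinear ℝ (Set.range (latticeToReal ∘ t))) {H : AddMonoidAlgebra k (I → Fin n → ℤ)}
    (hH : ∀ j : Fin 3, H ∣ genMinor k e (t ∘ j.succAbove)) :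
    ∃ x b, b ≠ 0 ∧ H = .single x b := by
  have hne : ∀ j : Fin 3, genMinor k e (t ∘ j.succAbove) ≠ 0 := fun j =>
    genMinor_ne_zero he (ht.comp Fin.succAbove_right_injective)
  refine isMonomial_of_subsingleton_support (fun h => hne 0 (zero_dvd_iff.1 (h ▸ hH 0))) ?_
  intro α hα β hβ
  obtain ⟨s, hs⟩ := exists_smul_of_dvd (hne 2) (hH 2) (fun γ => support_genMinor_fin_two) hα hβ
  obtain ⟨s', hs'⟩ := exists_smul_of_dvd (hne 0) (hH 0) (fun γ => support_genMinor_fin_two) hα hβ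
  have h0 := hs (e 0)
  have h0' := hs' (e 0)
  simp only [exponentOf_apply he, Function.comp_apply, Equiv.swap_apply_left] at h0 h0'
  rw [h0] at h0'
  change s • (latticeToReal (t 1) - latticeToReal (t 0)) =
    s' • (latticeToReal (t 2) - latticeToReal (t 1)) at h0'
  have hs0 : s = 0 := by
    by_contra hs0
    apply hc
    rw [collinear_iff_of_mem (p₀ := latticeToReal (t 1)) (Set.mem_range_self (f := latticeToReal ∘ t) 1)]
    refine ⟨latticeToReal (t 2) - latticeToReal (t 1), ?_⟩
    rintro _ ⟨l, rfl⟩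
    fin_cases l
    · refine ⟨-(s⁻¹ * s'), ?_⟩
      simp only [Fin.zero_eta, Function.comp_apply, vadd_eq_add]
      rw [neg_smul, mul_smul, ← h0', inv_smul_smul₀ hs0]
      abel
    · exact ⟨0, by simp⟩
    · exact ⟨1, by simp⟩
  funext i
  have := hs i
  rw [hs0, zero_smul, sub_eq_zero] at this
  exact latticeToReal_injective this

theorem exists_perm_apply_eq {r : ℕ} {a b c d : Fin r} (hab : a ≠ b) (hcd : c ≠ d) :
    ∃ σ : Equiv.Perm (Fin r), σ a = c ∧ σ b = d := by
  refine ⟨(Equiv.swap a c).trans (Equiv.swap (Equiv.swap a c b) d), ?_, ?_⟩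
  · rw [Equiv.trans_apply, Equiv.swap_apply_left, Equiv.swap_apply_of_ne_of_ne _ hcd]
    intro h
    apply hab
    exact (Equiv.swap a c).injective ((Equiv.swap_apply_left a c).trans h)
  · simp

/-- The maximal minors obtained by leaving out one of the monomials of a non-collinear family have
no common factor other than monomials. -/
theorem isMonomial_of_dvd_genMinor [Finite I] {r : ℕ} (hr : 2 ≤ r) :
    ∀ {e : Fin r → I} (_ : Function.Injective e) {t : Fin (r + 1) → Fin n → ℤ}
      (_ : Function.Injective t) (_ : ¬ Collinear ℝ (Set.range (latticeToReal ∘ t)))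
      {H : AddMonoidAlgebra k (I → Fin n → ℤ)}
      (_ : ∀ j : Fin (r + 1), H ∣ genMinor k e (t ∘ j.succAbove)),
      ∃ x b, b ≠ 0 ∧ H = .single x b := by
  induction r, hr using Nat.le_induction with
  | base => exact fun he _ ht hc _ hH => isMonomial_of_dvd_genMinor_two he ht hc hH
  | succ r hr ih =>
  intro e he t ht hc H hH
  have hne : ∀ j : Fin (r + 2), genMinor k e (t ∘ j.succAbove) ≠ 0 := fun j =>
    genMinor_ne_zero he (ht.comp Fin.succAbove_right_injective)
  have hH0 : H ≠ 0 := fun h => hne 0 (zero_dvd_iff.1 (h ▸ hH 0))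
  -- The leading form of `H` in the variable `x_{e a}` divides the leading forms of all minors that
  -- keep `t m`. Up to units these are the minors for the row set without `a` and the family without
  -- `t m`, so the induction hypothesis makes the leading form of `H` a monomial.
  have hlead : ∀ (w : Module.Dual ℝ (Fin n → ℝ)) (m : Fin (r + 2)),
      (∀ l, l ≠ m → w (latticeToReal (t l)) < w (latticeToReal (t m))) →
      ¬ Collinear ℝ (Set.range (latticeToReal ∘ (t ∘ m.succAbove))) →
      ∀ a, ∃ x c b, b ≠ 0 ∧ IsLeadingForm (weightAt (e a) w) c H (.single x b) := by
    intro w m hm hcm a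
    obtain ⟨c, h, h0, hlf⟩ := exists_isLeadingForm (weightAt (e a) w) hH0
    obtain ⟨x, b, hb, rfl⟩ := ih (e := e ∘ a.succAbove) (t := t ∘ m.succAbove) (H := h)
      (he.comp Fin.succAbove_right_injective) (ht.comp Fin.succAbove_right_injective) hcm (by
        intro j
        -- After deletion of column `m.succAbove j`, column `m` sits at position `j.predAbove m`;
        -- deleting both columns in either order leaves the same family.
        have hcol : (m.succAbove j).succAbove (j.predAbove m) = m :=
          Fin.succAbove_succAbove_predAbove m j
        have h1 := isLeadingForm_genMinor (k := k) he (t := t ∘ (m.succAbove j).succAbove) a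
          (j.predAbove m) w (by
            intro l hl
            simp only [Function.comp_apply, hcol]
            apply hm
            exact fun h => hl (Fin.succAbove_right_injective (h.trans hcol.symm)))
        have h2 : (t ∘ (m.succAbove j).succAbove) ∘ (j.predAbove m).succAbove =
            (t ∘ m.succAbove) ∘ j.succAbove := by
          funext l
          simp only [Function.comp_apply, Fin.succAbove_succAbove_succAbove_predAbove]
        rw [h2] at h1
        have hu : IsUnit ((-1 : AddMonoidAlgebra k (I → Fin n → ℤ)) ^
            (a + (j.predAbove m : Fin (r + 1)) : ℕ) *
            monomialAt k (e a) ((t ∘ (m.succAbove j).succAbove) (j.predAbove m))) :=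
          ((isUnit_one.neg).pow _).mul (isUnit_monomialAt _ _)
        have h3 := hlf.dvd h1 h0 (mul_ne_zero hu.ne_zero (genMinor_ne_zero
          (he.comp Fin.succAbove_right_injective)
          ((ht.comp Fin.succAbove_right_injective).comp Fin.succAbove_right_injective)))
          (hH _)
        exact (hu.dvd_mul_left).1 h3)
    exact ⟨x, c, b, hb, hlf⟩
  obtain ⟨w, m, m', ⟨hm, hm'⟩, hcm, hcm'⟩ := exists_dual_hasExtremes (r := r + 1) (by omega)
    (latticeToReal_injective.comp ht) hc
  have hmm : m ≠ m' := by
    rintro rfl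
    obtain ⟨l, hl⟩ : ∃ l : Fin (r + 2), l ≠ m := exists_ne m
    exact lt_asymm (hm l hl) (hm' l hl)
  have hlead₁ := hlead w m hm hcm
  have hlead₂ := hlead (-w) m' (fun l hl => by simpa using hm' l hl) hcm'
  choose x c b hb hx using hlead₁
  choose y c' b' hb' hy using hlead₂
  -- The minor omitting such a `j` contains both extreme exponents `t m` and `t m'`.
  obtain ⟨j, hj⟩ : ∃ j : Fin (r + 2), j ∉ ({m, m'} : Finset (Fin (r + 2))) := by
    by_contra! hall
    have h1 : (Finset.univ : Finset (Fin (r + 2))).card ≤ 2 :=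
      (Finset.card_le_card (fun j _ => hall j)).trans Finset.card_le_two
    rw [Finset.card_univ, Fintype.card_fin] at h1
    omega
  simp only [Finset.mem_insert, Finset.mem_singleton, not_or] at hj
  obtain ⟨q, hq⟩ := Fin.exists_succAbove_eq (Ne.symm hj.1)
  obtain ⟨q', hq'⟩ := Fin.exists_succAbove_eq (Ne.symm hj.2)
  have hqq : q ≠ q' := by
    rintro rfl
    exact hmm (hq.symm.trans hq')
  -- That minor has a monomial with `t m` in row `a` and `t m'` in row `a'`, extremal for both
  -- weights at once. This requires `a ≠ a'`.
  have hxy : ∀ a a', a ≠ a' → x a = y a' := by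
    intro a a' haa
    obtain ⟨σ, hσ, hσ'⟩ := exists_perm_apply_eq haa hqq
    refine leading_monomials_eq (hH j) (hx a) (hb a) (hy a') (hb' a')
      (exponentOf_mem_support_genMinor he (ht.comp Fin.succAbove_right_injective) σ) ?_ ?_
    · intro γ hγ
      obtain ⟨l, hl⟩ := exists_apply_eq_of_mem_support_genMinor he hγ a
      simp only [weightAt_apply, exponentOf_apply he, hl, Function.comp_apply, hσ, hq]
      by_cases h : j.succAbove l = m
      · rw [h]
      · exact (hm _ h).le
    · intro γ hγ
      obtain ⟨l, hl⟩ := exists_apply_eq_of_mem_support_genMinor he hγ a'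
      simp only [weightAt_apply, exponentOf_apply he, hl, Function.comp_apply, hσ', hq',
        LinearMap.neg_apply, neg_le_neg_iff]
      by_cases h : j.succAbove l = m'
      · rw [h]
      · exact (hm' _ h).le
  let a₀ : Fin (r + 1) := ⟨0, by omega⟩
  let a₁ : Fin (r + 1) := ⟨1, by omega⟩
  let a₂ : Fin (r + 1) := ⟨2, by omega⟩
  -- A third row reaches the diagonal case: `x a₀ = y a₁ = x a₂ = y a₀`.
  have hxy₀ : x a₀ = y a₀ := by
    rw [hxy a₀ a₁ (by simp [a₀, a₁]), ← hxy a₂ a₁ (by simp [a₁, a₂]),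
      hxy a₂ a₀ (by simp [a₀, a₂])]
  -- Top and bottom weight of `H` in row `a₀` now agree, so `H` equals its leading form.
  have hall : ∀ α ∈ H.coeff.support, α = x a₀ := by
    intro α hα
    have h1 := (hx a₀).weight_le hα
    have h2 := (hy a₀).weight_le hα
    have h3 := (hx a₀).weight_eq (x a₀) (by simp [hb])
    have h4 := (hy a₀).weight_eq (x a₀) (by simp [hb', hxy₀])
    simp only [weightAt_apply, LinearMap.neg_apply] at h1 h2 h3 h4
    have h5 := (hx a₀).mem_support_right hα (by rw [weightAt_apply]; linarith)
    simpa using Finsupp.support_single_subset h5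
  exact isMonomial_of_subsingleton_support hH0
    fun α hα β hβ => (hall α hα).trans (hall β hβ).symm

end Coprime

/-! ### Unique factorization for Laurent polynomials -/

section LaurentUFD

variable (k : Type*) [Field k] (I : Type*) (n : ℕ)

/-- The exponents in `ℤⁿ` of a monomial with natural exponents. -/
def natExponent {I : Type*} {n : ℕ} : (I × Fin n →₀ ℕ) →+ (I → Fin n → ℤ) where
  toFun m i j := m (i, j)
  map_zero' := rfl
  map_add' m m' := by ext; simp

theorem natExponent_injective {I : Type*} {n : ℕ} :
    Function.Injective (natExponent (I := I) (n := n)) := by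
  intro m m' h
  ext ⟨i, j⟩
  have := congrFun (congrFun h i) j
  simpa [natExponent] using this

theorem mem_range_natExponent [Finite I] {γ : I → Fin n → ℤ} (h : ∀ i j, 0 ≤ γ i j) :
    γ ∈ Set.range (natExponent (I := I) (n := n)) := by
  refine ⟨Finsupp.equivFunOnFinite.symm fun q => (γ q.1 q.2).toNat, ?_⟩
  ext i j
  simpa [natExponent] using h i j

/-- The inclusion of polynomials into Laurent polynomials. -/
noncomputable def polynomialToLaurent :
    MvPolynomial (I × Fin n) k →+* AddMonoidAlgebra k (I → Fin n → ℤ) :=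
  AddMonoidAlgebra.mapDomainRingHom k (natExponent (I := I) (n := n))

theorem polynomialToLaurent_injective : Function.Injective (polynomialToLaurent k I n) :=
  AddMonoidAlgebra.mapDomain_injective natExponent_injective

theorem polynomialToLaurent_monomial (m : I × Fin n →₀ ℕ) (c : k) :
    polynomialToLaurent k I n (MvPolynomial.monomial m c) = .single (natExponent m) c :=
  AddMonoidAlgebra.mapDomain_single

/-- The submonoid of monic monomials. -/
noncomputable def monicMonomials : Submonoid (MvPolynomial (I × Fin n) k) :=
  MonoidHom.mrange (MvPolynomial.monomialOneHom k (I × Fin n))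

variable [Finite I]

theorem exists_nonneg_translate (f : AddMonoidAlgebra k (I → Fin n → ℤ)) :
    ∃ m : I × Fin n →₀ ℕ, ∀ γ ∈ f.coeff.support, ∀ i j, 0 ≤ natExponent m i j + γ i j := by
  refine ⟨Finsupp.equivFunOnFinite.symm fun q =>
    ∑ γ ∈ f.coeff.support, (γ q.1 q.2).natAbs, fun γ hγ i j => ?_⟩
  have h1 : (γ i j).natAbs ≤ ∑ γ ∈ f.coeff.support, (γ i j).natAbs :=
    Finset.single_le_sum (f := fun γ : I → Fin n → ℤ => (γ i j).natAbs)
      (fun _ _ => Nat.zero_le _) hγ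
  have h2 : natExponent (Finsupp.equivFunOnFinite.symm fun q : I × Fin n =>
    ∑ γ ∈ f.coeff.support, (γ q.1 q.2).natAbs) i j =
      ((∑ γ ∈ f.coeff.support, (γ i j).natAbs : ℕ) : ℤ) := rfl
  rw [h2]
  omega

/-- Laurent polynomials are polynomials with the monomials inverted: multiplication by a large
monomial clears the finitely many negative exponents. Unique factorization then passes from
polynomials to the localization. -/
theorem isLocalization_laurent :
    letI := (polynomialToLaurent k I n).toAlgebra
    IsLocalization (monicMonomials k I n) (AddMonoidAlgebra k (I → Fin n → ℤ)) := by
  let := (polynomialToLaurent k I n).toAlgebra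
  have hmap : ∀ x, algebraMap (MvPolynomial (I × Fin n) k)
    (AddMonoidAlgebra k (I → Fin n → ℤ)) x = polynomialToLaurent k I n x := fun _ => rfl
  refine ⟨⟨?_, ?_, ?_⟩⟩
  · rintro ⟨_, m, rfl⟩
    rw [hmap]
    refine IsUnit.of_mul_eq_one (.single (-natExponent m.toAdd) 1) ?_
    refine (congrArg (· * _) (polynomialToLaurent_monomial k I n m.toAdd 1)).trans ?_
    rw [AddMonoidAlgebra.single_mul_single, add_neg_cancel, one_mul, AddMonoidAlgebra.one_def]
  · intro f
    obtain ⟨m, hm⟩ := exists_nonneg_translate k I n f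
    have hex : ∃ q, polynomialToLaurent k I n q = .single (natExponent m) 1 * f := by
      refine ⟨AddMonoidAlgebra.comapDomain natExponent natExponent_injective _,
        AddMonoidAlgebra.mapDomain_comapDomain ?_ natExponent_injective⟩
      intro γ hγ
      obtain ⟨α, hα, β, hβ, rfl⟩ := exists_add_of_mem_support_mul hγ
      have : α = natExponent m := by simpa using Finsupp.support_single_subset hα
      subst this
      exact mem_range_natExponent I n (hm β hβ)
    obtain ⟨q, hq⟩ := hex
    refine ⟨(q, ⟨MvPolynomial.monomial m 1, Multiplicative.ofAdd m, rfl⟩), ?_⟩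
    rw [hmap, hmap, hq, polynomialToLaurent_monomial, mul_comm]
  · intro x y h
    exact ⟨1, by rw [polynomialToLaurent_injective k I n h]⟩

theorem uniqueFactorizationMonoid_laurent :
    UniqueFactorizationMonoid (AddMonoidAlgebra k (I → Fin n → ℤ)) := by
  let := (polynomialToLaurent k I n).toAlgebra
  have := isLocalization_laurent k I n
  exact UniqueFactorizationMonoid.of_isLocalization (monicMonomials k I n) _

end LaurentUFD

/-! ### Linear systems with one more unknown than equations -/

section Kernel

/-- Two vectors in the kernel of a matrix with one more column than rows are proportional if some
maximal minor does not vanish. -/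
theorem mul_eq_mul_of_mulVec_eq_zero {R : Type*} [CommRing R] [IsDomain R] {p : ℕ}
    (M : Matrix (Fin p) (Fin (p + 1)) R) {D Z : Fin (p + 1) → R} (hD : M.mulVec D = 0)
    (hZ : M.mulVec Z = 0) {j : Fin (p + 1)} (hj : (M.submatrix id j.succAbove).det ≠ 0)
    (l : Fin (p + 1)) : Z l * D j = Z j * D l := by
  -- This kernel vector vanishes at `j`, so the remaining coordinates solve a square system with
  -- nonzero determinant.
  set v : Fin (p + 1) → R := D j • Z - Z j • D with hv
  have hMv : M.mulVec v = 0 := by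
    rw [hv, Matrix.mulVec_sub, Matrix.mulVec_smul, Matrix.mulVec_smul, hD, hZ]
    simp
  have hvj : v j = 0 := by simp [hv, mul_comm]
  have hv0 : (M.submatrix id j.succAbove).mulVec (v ∘ j.succAbove) = 0 := by
    funext a
    have := congrFun hMv a
    simp only [Matrix.mulVec, dotProduct, Pi.zero_apply] at this ⊢
    rw [Fin.sum_univ_succAbove _ j, hvj, mul_zero, zero_add] at this
    exact this
  have h0 := Matrix.eq_zero_of_mulVec_eq_zero hj hv0
  have hl : v l = 0 := by
    rcases Fin.eq_self_or_eq_succAbove j l with rfl | ⟨l, rfl⟩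
    · exact hvj
    · exact congrFun h0 l
  simp only [hv, Pi.sub_apply, Pi.smul_apply, smul_eq_mul, sub_eq_zero] at hl
  rw [mul_comm, hl]

/-- In a unique factorization domain, a vector proportional to one whose entries have no common
factor is a multiple of it. -/
theorem exists_eq_mul_of_proportional {R ι : Type*} [CommRing R] [UniqueFactorizationMonoid R]
    [IsDomain R] {D Z : ι → R} {j : ι} (hj : D j ≠ 0) (h : ∀ l, Z l * D j = Z j * D l)
    (hcop : ∀ H, (∀ l, H ∣ D l) → IsUnit H) : ∃ G, ∀ l, Z l = D l * G := by
  obtain ⟨a, b, c, hrel, hca, hcb⟩ :=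
    UniqueFactorizationMonoid.exists_reduced_factors' (Z j) (D j) hj
  have hc : c ≠ 0 := by rintro rfl; simp at hcb; exact hj hcb.symm
  have key : ∀ l, Z l * b = a * D l := by
    intro l
    apply mul_left_cancel₀ hc
    have := h l
    rw [← hca, ← hcb] at this
    linear_combination this
  -- The reduced denominator `b` is coprime to `a` and divides each `a * D l`, hence is a common
  -- factor of the `D l`.
  have hb : IsUnit b := by
    refine hcop b fun l => ?_
    exact hrel.symm.dvd_of_dvd_mul_left ((Dvd.intro_left (Z l) (key l)))
  obtain ⟨u, rfl⟩ := hb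
  refine ⟨a * ↑u⁻¹, fun l => ?_⟩
  have := key l
  rw [← Units.eq_mul_inv_iff_mul_eq] at this
  rw [this]
  ring

end Kernel

/-! ### Permuting the variables; solutions as multiples of the signed minors -/

section PermutationAction

variable {k : Type*} [Field k] {n p : ℕ}

/-- The action of a permutation of the variables. -/
noncomputable def permAct (σ : Equiv.Perm (Fin p)) :
    AddMonoidAlgebra k (Fin p → Fin n → ℤ) →+* AddMonoidAlgebra k (Fin p → Fin n → ℤ) :=
  AddMonoidAlgebra.mapDomainRingHom k
    ({ toFun := fun γ => γ ∘ σ, map_zero' := rfl, map_add' := fun _ _ => rfl } :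
      (Fin p → Fin n → ℤ) →+ (Fin p → Fin n → ℤ))

theorem permAct_single (σ : Equiv.Perm (Fin p)) (γ : Fin p → Fin n → ℤ) (c : k) :
    permAct σ (.single γ c) = .single (γ ∘ σ) c :=
  AddMonoidAlgebra.mapDomain_single

theorem permAct_smul (σ : Equiv.Perm (Fin p)) (c : k)
    (f : AddMonoidAlgebra k (Fin p → Fin n → ℤ)) : permAct σ (c • f) = c • permAct σ f := by
  have h : ∀ g : AddMonoidAlgebra k (Fin p → Fin n → ℤ), c • g = .single 0 c * g := by
    intro g
    ext γ
    rw [AddMonoidAlgebra.coeff_single_zero_mul]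
    rfl
  rw [h, h, map_mul, permAct_single]
  rfl

theorem coeff_permAct (σ : Equiv.Perm (Fin p)) (f : AddMonoidAlgebra k (Fin p → Fin n → ℤ))
    (γ : Fin p → Fin n → ℤ) : (permAct σ f).coeff (γ ∘ σ) = f.coeff γ := by
  refine Finsupp.mapDomain_apply (f := fun γ : Fin p → Fin n → ℤ => γ ∘ σ) ?_ _ _
  intro γ γ' h
  ext i : 1
  simpa using congrFun h (σ⁻¹ i)

theorem permAct_monomialAt (σ : Equiv.Perm (Fin p)) (i : Fin p) (P : Fin n → ℤ) :
    permAct σ (monomialAt k (σ i) P) = monomialAt k i P := by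
  rw [monomialAt, permAct_single, monomialAt]
  congr 1
  ext j : 1
  simp only [Function.comp_apply, Pi.single_apply, EmbeddingLike.apply_eq_iff_eq]

/-- The sign of a permutation as a Laurent polynomial. -/
noncomputable def signAt (k : Type*) [Field k] {p : ℕ} (n : ℕ) (σ : Equiv.Perm (Fin p)) :
    AddMonoidAlgebra k (Fin p → Fin n → ℤ) := ((Equiv.Perm.sign σ : ℤ) : _)

theorem signAt_mul_self (σ : Equiv.Perm (Fin p)) : signAt k n σ * signAt k n σ = 1 := by
  rw [signAt, ← Int.cast_mul, ← Units.val_mul, Int.units_mul_self]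
  simp

theorem permAct_genMinor (σ : Equiv.Perm (Fin p)) (t : Fin p → Fin n → ℤ) :
    permAct σ (genMinor k id t) = signAt k n σ * genMinor k id t := by
  have h := Matrix.det_permute σ⁻¹ (Matrix.of fun a l => monomialAt k (a : Fin p) (t l))
  rw [Equiv.Perm.sign_inv] at h
  refine Eq.trans ?_ h
  rw [genMinor, RingHom.map_det]
  congr 1
  ext1 a l
  have := permAct_monomialAt (k := k) σ (σ⁻¹ a) (t l)
  rw [show σ (σ⁻¹ a) = a from σ.apply_symm_apply a] at this
  exact this

/-- The minors with the signs of the Laplace expansion. -/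
noncomputable def signedMinor (k : Type*) [Field k] {n p : ℕ} (t : Fin (p + 1) → Fin n → ℤ)
    (l : Fin (p + 1)) : AddMonoidAlgebra k (Fin p → Fin n → ℤ) :=
  (-1) ^ (l : ℕ) * genMinor k id (t ∘ l.succAbove)

/-- The sum is the expansion of a determinant in which row `i` has been repeated on top. -/
theorem sum_monomialAt_mul_signedMinor (t : Fin (p + 1) → Fin n → ℤ) (i : Fin p) :
    ∑ l, monomialAt k i (t l) * signedMinor k t l = 0 := by
  have h : genMinor k (Fin.cons i id : Fin (p + 1) → Fin p) t = 0 := by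
    refine Matrix.det_zero_of_row_eq (Fin.succ_ne_zero i).symm ?_
    funext l
    simp
  rw [genMinor_succ _ _ 0] at h
  refine Eq.trans (Finset.sum_congr rfl fun l _ => ?_) h
  have : (Fin.cons i id : Fin (p + 1) → Fin p) ∘ (0 : Fin (p + 1)).succAbove = id := by
    funext a
    simp
  rw [this, signedMinor, Fin.cons_zero, Fin.val_zero, zero_add]
  ring

theorem permAct_signedMinor (σ : Equiv.Perm (Fin p)) (t : Fin (p + 1) → Fin n → ℤ)
    (l : Fin (p + 1)) : permAct σ (signedMinor k t l) = signAt k n σ * signedMinor k t l := by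
  rw [signedMinor, map_mul, permAct_genMinor, map_pow, map_neg, map_one]
  ring

theorem associated_signedMinor (t : Fin (p + 1) → Fin n → ℤ) (l : Fin (p + 1)) :
    Associated (genMinor k id (t ∘ l.succAbove)) (signedMinor k t l) := by
  have hu : IsUnit ((-1 : AddMonoidAlgebra k (Fin p → Fin n → ℤ)) ^ (l : ℕ)) :=
    (isUnit_one.neg).pow _
  rw [signedMinor]
  exact (associated_unit_mul_left _ _ hu).symm

theorem signedMinor_ne_zero {t : Fin (p + 1) → Fin n → ℤ} (ht : Function.Injective t)
    (l : Fin (p + 1)) : signedMinor k t l ≠ 0 :=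
  (associated_signedMinor t l).ne_zero_iff.1
    (genMinor_ne_zero Function.injective_id (ht.comp Fin.succAbove_right_injective))

theorem exists_mem_support_signedMinor {t : Fin (p + 1) → Fin n → ℤ} (ht : Function.Injective t)
    {l m : Fin (p + 1)} (hlm : m ≠ l) (i : Fin p) :
    ∃ γ ∈ (signedMinor k t l).coeff.support, γ i = t m := by
  obtain ⟨q, rfl⟩ := Fin.exists_succAbove_eq hlm
  refine ⟨exponentOf id ((t ∘ l.succAbove) ∘ Equiv.swap i q), ?_, ?_⟩
  · have h := exponentOf_mem_support_genMinor (k := k) Function.injective_id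
      (ht.comp Fin.succAbove_right_injective) (Equiv.swap i q) (t := t ∘ l.succAbove)
    rw [signedMinor]
    rcases neg_one_pow_eq_or (AddMonoidAlgebra k (Fin p → Fin n → ℤ)) (l : ℕ) with h1 | h1 <;>
      rw [h1]
    · simpa using h
    · rw [Finsupp.mem_support_iff] at h ⊢
      simpa using h
  · exact (exponentOf_apply Function.injective_id _ i).trans (by simp)

theorem isUnit_single (x : Fin p → Fin n → ℤ) {b : k} (hb : b ≠ 0) :
    IsUnit (AddMonoidAlgebra.single x b) := by
  refine IsUnit.of_mul_eq_one (.single (-x) b⁻¹) ?_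
  rw [AddMonoidAlgebra.single_mul_single, add_neg_cancel, mul_inv_cancel₀ hb]
  rfl

/-- Solutions of the linear system with coefficients `x_i ^ (t l)` are multiples of the vector of
signed minors. -/
theorem exists_eq_signedMinor_mul (hp : 2 ≤ p) {t : Fin (p + 1) → Fin n → ℤ}
    (ht : Function.Injective t) (hc : ¬ Collinear ℝ (Set.range (latticeToReal ∘ t)))
    {Z : Fin (p + 1) → AddMonoidAlgebra k (Fin p → Fin n → ℤ)}
    (hZ : ∀ i, ∑ l, monomialAt k i (t l) * Z l = 0) : ∃ G, ∀ l, Z l = signedMinor k t l * G := by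
  have := uniqueFactorizationMonoid_laurent k (Fin p) n
  refine exists_eq_mul_of_proportional (j := 0) (signedMinor_ne_zero ht 0) ?_ ?_
  · refine mul_eq_mul_of_mulVec_eq_zero (Matrix.of fun i l => monomialAt k i (t l))
      (funext fun i => sum_monomialAt_mul_signedMinor t i) (funext fun i => hZ i) ?_
    exact genMinor_ne_zero Function.injective_id (ht.comp Fin.succAbove_right_injective)
  · intro H hH
    obtain ⟨x, b, hb, rfl⟩ := isMonomial_of_dvd_genMinor hp Function.injective_id ht hc
      fun j => (hH j).trans (associated_signedMinor t j).symm.dvd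
    exact isUnit_single x hb

/-- `Z l` and the signed minor change by the same sign, which cancels in the domain; one index `l`
suffices. -/
theorem permAct_eq_of_signedMinor_mul {t : Fin (p + 1) → Fin n → ℤ} (ht : Function.Injective t)
    {Z : Fin (p + 1) → AddMonoidAlgebra k (Fin p → Fin n → ℤ)}
    (hZ : ∀ σ l, permAct σ (Z l) = signAt k n σ * Z l)
    {G : AddMonoidAlgebra k (Fin p → Fin n → ℤ)} (hG : ∀ l, Z l = signedMinor k t l * G)
    (σ : Equiv.Perm (Fin p)) : permAct σ G = G := by
  have h := hZ σ 0
  rw [hG 0, map_mul, permAct_signedMinor] at h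
  have h1 : signAt k n σ * signedMinor k t 0 * (permAct σ G - G) = 0 := by
    linear_combination h
  have h2 : signAt k n σ ≠ 0 := left_ne_zero_of_mul_eq_one (signAt_mul_self σ)
  rcases mul_eq_zero.1 h1 with h3 | h3
  · exact absurd h3 (mul_ne_zero h2 (signedMinor_ne_zero ht 0))
  · exact sub_eq_zero.1 h3

/-- If the products of `G` with all signed minors have their exponents in `S`, and each point
outside `S` can be separated from `S`, then the exponents of `G` translate `t` into `S`. -/
theorem mem_of_support_signedMinor_mul (hp : 0 < p) {t : Fin (p + 1) → Fin n → ℤ}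
    (ht : Function.Injective t) {S : Set (Fin n → ℤ)}
    (hS : ∀ P, P ∉ S → ∃ w : Module.Dual ℝ (Fin n → ℝ),
      ∀ s ∈ S, w (latticeToReal s) < w (latticeToReal P))
    {G : AddMonoidAlgebra k (Fin p → Fin n → ℤ)}
    (hG : ∀ l, ∀ γ ∈ (signedMinor k t l * G).coeff.support, ∀ i, γ i ∈ S)
    {γ : Fin p → Fin n → ℤ} (hγ : γ ∈ G.coeff.support) (i : Fin p) (m : Fin (p + 1)) :
    γ i + t m ∈ S := by
  by_contra hnot
  obtain ⟨w, hw⟩ := hS _ hnot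
  have : Nontrivial (Fin (p + 1)) := Fin.nontrivial_iff_two_le.2 (by omega)
  -- The minor must retain the exponent `t m`, so a different column is omitted.
  obtain ⟨l, hl⟩ := exists_ne m
  obtain ⟨β, hβ, hβi⟩ := exists_mem_support_signedMinor (k := k) ht hl.symm i
  obtain ⟨α, hα, hle⟩ := exists_mem_support_mul_weight_ge (weightAt i w) hβ hγ
  have h1 := hw _ (hG l α hα i)
  rw [← map_add, weightAt_apply, weightAt_apply, Pi.add_apply, hβi, add_comm] at hle
  exact absurd h1 (not_lt.2 hle)

end PermutationAction

/-! ### Exterior powers as alternating Laurent polynomials -/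

section Exterior

variable (k : Type*) [Field k] {I : Type*} [DecidableEq I] {n : ℕ} (S : Set (Fin n → ℤ))

/-- The linear map `V_S → k[x_i^±]` that sends the basis vector `P` to `x_i ^ P`. -/
noncomputable def monomialMap (i : I) : (S →₀ k) →ₗ[k] AddMonoidAlgebra k (I → Fin n → ℤ) :=
  Finsupp.linearCombination k fun P : S => monomialAt k i (P : Fin n → ℤ)

theorem monomialMap_single (i : I) (P : S) :
    monomialMap k S i (Finsupp.single P 1) = monomialAt k i (P : Fin n → ℤ) := by
  simp [monomialMap]

/-- The alternating map that sends `(v₁, …, v_r)` to the determinant of the `v_b(x_{e a})`. -/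
noncomputable def detMap {r : ℕ} (e : Fin r → I) :
    (S →₀ k) [⋀^Fin r]→ₗ[k] AddMonoidAlgebra k (I → Fin n → ℤ) where
  toMultilinearMap :=
    ((Matrix.detRowAlternating (n := Fin r)
      (R := AddMonoidAlgebra k (I → Fin n → ℤ))).toMultilinearMap.restrictScalars k).compLinearMap
      fun _ => LinearMap.pi fun a => monomialMap k S (e a)
  map_eq_zero_of_eq' v i j h hij := by
    refine (Matrix.detRowAlternating (n := Fin r)
      (R := AddMonoidAlgebra k (I → Fin n → ℤ))).map_eq_zero_of_eq _ ?_ hij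
    simp [h]

theorem detMap_single {r : ℕ} (e : Fin r → I) (P : Fin r → S) :
    detMap k S e (fun b => Finsupp.single (P b) 1) = genMinor k e fun b => (P b : Fin n → ℤ) := by
  rw [genMinor, ← Matrix.det_transpose]
  change Matrix.det (Matrix.of fun b a => monomialMap k S (e a) (Finsupp.single (P b) 1)) = _
  congr 1
  ext1 b a
  simp [monomialMap_single]

/-- The linear map `⋀ʳ V_S → k[x_i^±]` that sends `P₁ ∧ … ∧ P_r` to the determinant of the
`x_{e a} ^ (P_b)`. -/
noncomputable def wedgeMap {r : ℕ} (e : Fin r → I) :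
    (⋀[k]^r (S →₀ k)) →ₗ[k] AddMonoidAlgebra k (I → Fin n → ℤ) :=
  exteriorPower.alternatingMapLinearEquiv (detMap k S e)

theorem wedgeMap_single {r : ℕ} (e : Fin r → I) (P : Fin r → S) :
    wedgeMap k S e (exteriorPower.ιMulti k r fun b => Finsupp.single (P b) 1) =
      genMinor k e fun b => (P b : Fin n → ℤ) := by
  rw [wedgeMap, exteriorPower.alternatingMapLinearEquiv_apply_ιMulti, detMap_single]

variable {S}

theorem linearMap_ext_wedge {r : ℕ} {M : Type*} [AddCommGroup M] [Module k M]
    {f g : (⋀[k]^r (S →₀ k)) →ₗ[k] M}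
    (h : ∀ P : Fin r → S, f (exteriorPower.ιMulti k r fun b => Finsupp.single (P b) 1) =
      g (exteriorPower.ιMulti k r fun b => Finsupp.single (P b) 1)) : f = g := by
  refine exteriorPower.linearMap_ext
    (Module.Basis.ext_alternating (Finsupp.basisSingleOne (R := k) (ι := S)) fun P _ => ?_)
  simpa using h P

variable (S)

theorem wedgeMap_injective {r : ℕ} {e : Fin r → I} (he : Function.Injective e) :
    Function.Injective (wedgeMap k S e) := by
  classical
  -- An arbitrary order, used only to index the basis of the exterior power by subsets.
  let _ : LinearOrder S := LinearOrder.lift' (fun P : S => toLex (P : Fin n → ℤ))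
    (fun P Q h => Subtype.ext (toLex.injective h))
  let B := (Finsupp.basisSingleOne (R := k) (ι := S)).exteriorPower r
  let P : Set.powersetCard S r → Fin r → Fin n → ℤ := fun s b =>
    (Set.powersetCard.ofFinEmbEquiv.symm s b : S)
  have hP : ∀ s, Function.Injective (P s) := fun s =>
    Subtype.val_injective.comp (Set.powersetCard.ofFinEmbEquiv.symm s).injective
  have hB : ∀ s, wedgeMap k S e (B s) = genMinor k e (P s) := by
    intro s
    rw [exteriorPower.basis_apply, exteriorPower.ιMulti_family]
    refine Eq.trans (congrArg _ (congrArg _ ?_)) (wedgeMap_single k S e _)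
    funext b
    simp
  -- Determinants of different subsets share no monomial, so one coefficient of the image reads off
  -- each basis coordinate.
  have hdual : ∀ s : Set.powersetCard S r,
      Finsupp.lapply (exponentOf e (P s)) ∘ₗ
        (AddMonoidAlgebra.coeffLinearEquiv k).toLinearMap ∘ₗ wedgeMap k S e = B.coord s := by
    intro s
    refine B.ext fun s' => ?_
    simp only [LinearMap.comp_apply, Finsupp.lapply_apply, Module.Basis.coord_apply,
      Module.Basis.repr_self, hB]
    change (genMinor k e (P s')).coeff (exponentOf e (P s)) = _
    by_cases hs : s' = s
    · subst hs
      have := coeff_genMinor (k := k) he (hP s') 1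
      simpa using this
    · rw [Finsupp.single_eq_of_ne (Ne.symm hs)]
      by_contra hne
      obtain ⟨σ, hσ⟩ := exists_perm_of_mem_support_genMinor (Finsupp.mem_support_iff.2 hne)
      have hPs : ∀ a, P s a = P s' (σ a) := by
        intro a
        have := congrFun hσ (e a)
        rwa [exponentOf_apply he, exponentOf_apply he] at this
      apply hs
      by_contra hss
      obtain ⟨x, hx, hx'⟩ := (Set.powersetCard.exists_mem_notMem_iff_ne s s').1 (Ne.symm hss)
      obtain ⟨a, rfl⟩ := (Set.powersetCard.mem_range_ofFinEmbEquiv_symm_iff_mem s x).2 hx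
      exact hx' ((Set.powersetCard.mem_range_ofFinEmbEquiv_symm_iff_mem s' _).1
        ⟨σ a, Subtype.ext (hPs a).symm⟩)
  refine (injective_iff_map_eq_zero _).2 fun x hx => ?_
  refine B.repr.map_eq_zero_iff.1 (Finsupp.ext fun s => ?_)
  rw [← Module.Basis.coord_apply, ← hdual]
  simp [hx]

end Exterior

/-! ### The kernel of the Koszul map as a linear equation -/

section Koszul

variable {k : Type*} [Field k] {n : ℕ} {S : Set (Fin n → ℤ)}

theorem wedge_induction {r : ℕ} {C : (⋀[k]^r (S →₀ k)) → Prop}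
    (single : ∀ P : Fin r → S, C (exteriorPower.ιMulti k r fun b => Finsupp.single (P b) 1))
    (add : ∀ x y, C x → C y → C (x + y)) (smul : ∀ (c : k) x, C x → C (c • x)) (zero : C 0)
    (x : ⋀[k]^r (S →₀ k)) : C x := by
  let N : Submodule k (⋀[k]^r (S →₀ k)) :=
    { carrier := {x | C x}
      add_mem' := fun {x y} hx hy => add x y hx hy
      smul_mem' := fun c x hx => smul c x hx
      zero_mem' := zero }
  have h : N.mkQ = 0 := by
    refine linearMap_ext_wedge k fun P => ?_
    rw [LinearMap.zero_apply, Submodule.mkQ_apply, Submodule.Quotient.mk_eq_zero]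
    exact single P
  have hx := LinearMap.congr_fun h x
  rw [LinearMap.zero_apply, Submodule.mkQ_apply, Submodule.Quotient.mk_eq_zero] at hx
  exact hx

theorem mem_of_support_wedgeMap {I : Type*} [DecidableEq I] {r : ℕ} {e : Fin r → I}
    (he : Function.Injective e) (x : ⋀[k]^r (S →₀ k)) :
    ∀ γ ∈ (wedgeMap k S e x).coeff.support, ∀ a, γ (e a) ∈ S := by
  induction x using wedge_induction with
  | single P =>
    intro γ hγ a
    rw [wedgeMap_single] at hγ
    obtain ⟨l, hl⟩ := exists_apply_eq_of_mem_support_genMinor he hγ a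
    rw [hl]
    exact (P l).2
  | add x y hx hy =>
    intro γ hγ a
    rw [map_add] at hγ
    rcases mem_support_add hγ with h | h
    exacts [hx γ h a, hy γ h a]
  | smul c x hx =>
    intro γ hγ a
    rw [map_smul] at hγ
    exact hx γ (Finsupp.support_smul hγ) a
  | zero =>
    intro γ hγ
    simp at hγ

theorem eq_zero_of_support_wedgeMap {I : Type*} [DecidableEq I] {r : ℕ} {e : Fin r → I}
    {i : I} (hi : ∀ a, e a ≠ i) (x : ⋀[k]^r (S →₀ k)) :
    ∀ γ ∈ (wedgeMap k S e x).coeff.support, γ i = 0 := by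
  induction x using wedge_induction with
  | single P =>
    intro γ hγ
    rw [wedgeMap_single] at hγ
    exact apply_eq_zero_of_mem_support_genMinor hγ hi
  | add x y hx hy =>
    intro γ hγ
    rw [map_add] at hγ
    rcases mem_support_add hγ with h | h
    exacts [hx γ h, hy γ h]
  | smul c x hx =>
    intro γ hγ
    rw [map_smul] at hγ
    exact hx γ (Finsupp.support_smul hγ)
  | zero =>
    intro γ hγ
    simp at hγ

theorem permAct_wedgeMap {p : ℕ} (σ : Equiv.Perm (Fin p)) (x : ⋀[k]^p (S →₀ k)) :
    permAct σ (wedgeMap k S id x) = signAt k n σ * wedgeMap k S id x := by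
  induction x using wedge_induction with
  | single P => rw [wedgeMap_single, permAct_genMinor]
  | add x y hx hy => rw [map_add, map_add, hx, hy, mul_add]
  | smul c x hx => rw [map_smul, permAct_smul, hx, mul_smul_comm]
  | zero => simp

/-- The sum of the `sgn σ · σ f`. -/
noncomputable def alternate {p : ℕ} (f : AddMonoidAlgebra k (Fin p → Fin n → ℤ)) :
    AddMonoidAlgebra k (Fin p → Fin n → ℤ) :=
  ∑ σ : Equiv.Perm (Fin p), signAt k n σ * permAct σ f

theorem alternate_single {p : ℕ} (γ : Fin p → Fin n → ℤ) (c : k) :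
    alternate (.single γ c) = c • genMinor k id γ := by
  rw [alternate, genMinor_eq_sum, Finset.smul_sum]
  refine Finset.sum_congr rfl fun σ _ => ?_
  have h : exponentOf id (γ ∘ σ) = γ ∘ σ :=
    funext fun a => exponentOf_apply (Function.injective_id) (γ ∘ σ) a
  rw [permAct_single, h, signAt, Units.smul_def, zsmul_eq_mul, ← mul_smul_comm,
    AddMonoidAlgebra.smul_single, smul_eq_mul, mul_one]

theorem alternate_add {p : ℕ} (f g : AddMonoidAlgebra k (Fin p → Fin n → ℤ)) :
    alternate (f + g) = alternate f + alternate g := by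
  simp only [alternate, map_add, mul_add, Finset.sum_add_distrib]

/-- Alternation is linear over symmetric elements. With a determinant written as the alternation of
one monomial, this avoids dividing by `p!`. -/
theorem alternate_mul {p : ℕ} {f g : AddMonoidAlgebra k (Fin p → Fin n → ℤ)}
    (hg : ∀ σ, permAct σ g = g) : alternate (f * g) = alternate f * g := by
  simp only [alternate, map_mul, hg, Finset.sum_mul, mul_assoc]

theorem alternate_mem_range {p : ℕ} {f : AddMonoidAlgebra k (Fin p → Fin n → ℤ)}
    (hf : ∀ γ ∈ f.coeff.support, ∀ a, γ a ∈ S) :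
    alternate f ∈ LinearMap.range (wedgeMap k S (id : Fin p → Fin p)) := by
  classical
  have hsum : ∀ s : Finset (Fin p → Fin n → ℤ), (∀ γ ∈ s, ∀ a, γ a ∈ S) →
      alternate (∑ γ ∈ s, AddMonoidAlgebra.single γ (f.coeff γ)) ∈
        LinearMap.range (wedgeMap k S (id : Fin p → Fin p)) := by
    intro s
    induction s using Finset.induction_on with
    | empty =>
      intro _
      rw [Finset.sum_empty, alternate]
      simp
    | insert γ s hγ ih =>
      intro h
      rw [Finset.sum_insert hγ, alternate_add, alternate_single]
      refine add_mem (Submodule.smul_mem _ _ ?_)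
        (ih fun γ' h' => h γ' (Finset.mem_insert_of_mem h'))
      exact ⟨_, wedgeMap_single k S id fun a => ⟨γ a, h γ (Finset.mem_insert_self _ _) a⟩⟩
  have h := hsum f.coeff.support hf
  have : ∑ γ ∈ f.coeff.support, AddMonoidAlgebra.single γ (f.coeff γ) = f :=
    AddMonoidAlgebra.sum_coeff_single f
  rwa [this] at h

theorem genMinor_eq_alternate {p : ℕ} (t : Fin p → Fin n → ℤ) :
    genMinor k id t = alternate (.single t 1) := by
  rw [alternate_single, one_smul]

/-- The product is, up to sign, the alternation of a single monomial times `G`. Its exponents lie in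
`S` before alternating, so the result is a combination of determinants with columns in `S`. -/
theorem signedMinor_mul_mem_range {p : ℕ} {t : Fin (p + 1) → Fin n → ℤ} (l : Fin (p + 1))
    {G : AddMonoidAlgebra k (Fin p → Fin n → ℤ)} (hG : ∀ σ, permAct σ G = G)
    (hsupp : ∀ γ ∈ G.coeff.support, ∀ a m, γ a + t m ∈ S) :
    signedMinor k t l * G ∈ LinearMap.range (wedgeMap k S (id : Fin p → Fin p)) := by
  have h : genMinor k id (t ∘ l.succAbove) * G ∈
      LinearMap.range (wedgeMap k S (id : Fin p → Fin p)) := by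
    rw [genMinor_eq_alternate, ← alternate_mul hG]
    refine alternate_mem_range fun γ hγ a => ?_
    obtain ⟨α, hα, β, hβ, rfl⟩ := exists_add_of_mem_support_mul hγ
    have : α = t ∘ l.succAbove := by simpa using Finsupp.support_single_subset hα
    subst this
    rw [Pi.add_apply, add_comm]
    exact hsupp β hβ a _
  rw [signedMinor]
  rcases neg_one_pow_eq_or (AddMonoidAlgebra k (Fin p → Fin n → ℤ)) (l : ℕ) with h1 | h1 <;>
    rw [h1]
  · simpa using h
  · simpa [neg_mul] using h

variable (k S) (T : Set (Fin n → ℤ))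

/-- The linear map `⋀ʳ V_S ⊗ V_T → ⊕_{Q ∈ T} k[x_i^±]` given by `wedgeMap` in each component. -/
noncomputable def componentMap {I : Type*} [DecidableEq I] {r : ℕ} (e : Fin r → I) :
    (⋀[k]^r (S →₀ k)) ⊗[k] (T →₀ k) →ₗ[k] (T →₀ AddMonoidAlgebra k (I → Fin n → ℤ)) :=
  Finsupp.mapRange.linearMap (wedgeMap k S e) ∘ₗ
    (TensorProduct.finsuppScalarRight k k (⋀[k]^r (S →₀ k)) T).toLinearMap

theorem componentMap_tmul_single {I : Type*} [DecidableEq I] {r : ℕ} (e : Fin r → I)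
    (x : ⋀[k]^r (S →₀ k)) (Q : T) :
    componentMap k S T e (x ⊗ₜ Finsupp.single Q 1) = Finsupp.single Q (wedgeMap k S e x) := by
  classical
  simp [componentMap, TensorProduct.finsuppScalarRight_apply_tmul]

theorem componentMap_injective {I : Type*} [DecidableEq I] {r : ℕ} {e : Fin r → I}
    (he : Function.Injective e) : Function.Injective (componentMap k S T e) := by
  rw [componentMap, LinearMap.coe_comp]
  exact (Finsupp.mapRange_injective _ (map_zero _) (wedgeMap_injective k S he)).comp
    (LinearEquiv.injective _)

theorem exists_componentMap_apply {I : Type*} [DecidableEq I] {r : ℕ} (e : Fin r → I)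
    (z : (⋀[k]^r (S →₀ k)) ⊗[k] (T →₀ k)) (Q : T) :
    ∃ x, componentMap k S T e z Q = wedgeMap k S e x :=
  ⟨TensorProduct.finsuppScalarRight k k (⋀[k]^r (S →₀ k)) T z Q, by simp [componentMap]⟩

theorem mem_range_componentMap {I : Type*} [DecidableEq I] {r : ℕ} (e : Fin r → I)
    {f : T →₀ AddMonoidAlgebra k (I → Fin n → ℤ)}
    (hf : ∀ Q, f Q ∈ LinearMap.range (wedgeMap k S e)) :
    f ∈ LinearMap.range (componentMap k S T e) := by
  classical
  induction f using Finsupp.induction with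
  | zero => exact zero_mem _
  | single_add Q c f hQ _ ih =>
    refine add_mem ?_ (ih fun Q' => ?_)
    · have h := hf Q
      rw [Finsupp.add_apply, Finsupp.single_eq_same, Finsupp.notMem_support_iff.1 hQ,
        add_zero] at h
      obtain ⟨x, rfl⟩ := h
      exact ⟨_, componentMap_tmul_single k S T e x Q⟩
    · by_cases h : Q' = Q
      · rw [h, Finsupp.notMem_support_iff.1 hQ]
        exact zero_mem _
      · have := hf Q'
        rwa [Finsupp.add_apply, Finsupp.single_eq_of_ne h, zero_add] at this

/-- The linear map `(f_Q)_Q ↦ ∑ x_i ^ Q f_Q`. -/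
noncomputable def evalMap {I : Type*} [DecidableEq I] (i : I) :
    (T →₀ AddMonoidAlgebra k (I → Fin n → ℤ)) →ₗ[k] AddMonoidAlgebra k (I → Fin n → ℤ) :=
  Finsupp.lsum k fun Q : T => LinearMap.mulLeft k (monomialAt k i (Q : Fin n → ℤ))

theorem evalMap_apply {I : Type*} [DecidableEq I] (i : I)
    (f : T →₀ AddMonoidAlgebra k (I → Fin n → ℤ)) :
    evalMap k T i f = f.sum fun Q g => monomialAt k i (Q : Fin n → ℤ) * g := rfl

/-- When the `f Q` do not involve `x_i`, the exponent of `x_i` in `x_i ^ Q f_Q` recovers `Q`, so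
nothing cancels. -/
theorem eq_zero_of_evalMap_eq_zero {I : Type*} [DecidableEq I] {i : I}
    {f : T →₀ AddMonoidAlgebra k (I → Fin n → ℤ)}
    (hf : ∀ Q, ∀ γ ∈ (f Q).coeff.support, γ i = 0) (h : evalMap k T i f = 0) : f = 0 := by
  ext Q γ
  by_contra hne
  have hγ : γ ∈ (f Q).coeff.support := Finsupp.mem_support_iff.2 hne
  have hcoeff : (evalMap k T i f).coeff (Pi.single i (Q : Fin n → ℤ) + γ) =
      (f Q).coeff γ := by
    rw [evalMap_apply, Finsupp.sum, AddMonoidAlgebra.coeff_sum, Finsupp.finsetSum_apply,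
      Finset.sum_eq_single Q]
    · rw [monomialAt, AddMonoidAlgebra.coeff_single_mul_eq_mul_coeff γ
        (fun _ _ => add_right_inj _), one_mul]
    · intro Q' _ hQ'
      by_contra hne'
      obtain ⟨α, hα, β, hβ, hαβ⟩ :=
        exists_add_of_mem_support_mul (Finsupp.mem_support_iff.2 hne')
      have h1 : α = Pi.single i (Q' : Fin n → ℤ) := by
        simpa using Finsupp.support_single_subset hα
      have h2 := congrFun hαβ i
      rw [Pi.add_apply, Pi.add_apply, hf Q' β hβ, hf Q γ hγ, h1, Pi.single_eq_same,
        Pi.single_eq_same, add_zero, add_zero] at h2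
      exact hQ' (Subtype.ext h2)
    · intro hQ
      rw [Finsupp.notMem_support_iff.1 hQ, mul_zero]
      rfl
  rw [h] at hcoeff
  exact hne hcoeff.symm

/-- Laplace expansion along row `0`: variable `0` is reserved for the removed factor and `Fin.succ`
supplies the others. The minus sign comes from numbering the factors from `1` in `δ`. -/
theorem evalMap_componentMap_koszulMap {r : ℕ}
    (z : (⋀[k]^(r + 1) (S →₀ k)) ⊗[k] (T →₀ k)) :
    evalMap k (S + T) 0 (componentMap k S (S + T) Fin.succ (koszulMap k S T (r + 1) z)) =
      -evalMap k T 0 (componentMap k S T id z) := by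
  have h : evalMap k (S + T) 0 ∘ₗ componentMap k S (S + T) Fin.succ ∘ₗ koszulMap k S T (r + 1) =
      -(evalMap k T 0 ∘ₗ componentMap k S T id) := by
    refine TensorProduct.ext (linearMap_ext_wedge k fun P => Finsupp.lhom_ext' fun Q =>
      LinearMap.ext_ring ?_)
    change evalMap k (S + T) 0 (componentMap k S (S + T) Fin.succ
      (koszulMap k S T (r + 1) (_ ⊗ₜ[k] Finsupp.single Q 1))) =
      -(evalMap k T 0 (componentMap k S T id (_ ⊗ₜ[k] Finsupp.single Q 1)))
    rw [koszulMap_single, componentMap_tmul_single, wedgeMap_single k S id P, map_sum, map_sum,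
      evalMap_apply, Finsupp.sum_single_index (mul_zero _), genMinor_succ id _ 0,
      Finset.mul_sum, ← Finset.sum_neg_distrib]
    refine Finset.sum_congr rfl fun i _ => ?_
    have h1 := componentMap_tmul_single k S (S + T) Fin.succ
      (exteriorPower.ιMulti k r (fun j => Finsupp.single (P (i.succAbove j)) (1 : k)))
      ⟨(P i : Fin n → ℤ) + (Q : Fin n → ℤ), Set.add_mem_add (P i).2 Q.2⟩
    have h2 : (id ∘ (0 : Fin (r + 1)).succAbove : Fin r → Fin (r + 1)) = Fin.succ := by
      funext a
      simp
    have h3 : monomialAt k (0 : Fin (r + 1)) ((P i : Fin n → ℤ) + (Q : Fin n → ℤ)) =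
        monomialAt k 0 (P i : Fin n → ℤ) * monomialAt k 0 (Q : Fin n → ℤ) := by
      rw [monomialAt, monomialAt, monomialAt, AddMonoidAlgebra.single_mul_single, one_mul,
        Pi.single_add]
    rw [map_smul, map_smul]
    refine (congrArg (fun x => _ • evalMap k (S + T) 0 x) h1).trans ?_
    rw [wedgeMap_single, evalMap_apply, Finsupp.sum_single_index (mul_zero _), h2, h3]
    simp only [id, Fin.val_zero, zero_add, Function.comp_def]
    rcases neg_one_pow_eq_or k (i : ℕ) with h4 | h4 <;>
      rcases Nat.even_or_odd (i : ℕ) with h5 | h5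
    all_goals
      rw [pow_succ, h5.neg_one_pow, h5.neg_one_pow]
      simp only [one_mul, neg_mul, one_smul, neg_smul, neg_neg, mul_neg]
      ring
  exact LinearMap.congr_fun h z

theorem koszulMap_eq_zero_iff {r : ℕ} (z : (⋀[k]^(r + 1) (S →₀ k)) ⊗[k] (T →₀ k)) :
    koszulMap k S T (r + 1) z = 0 ↔ evalMap k T 0 (componentMap k S T id z) = 0 := by
  rw [← neg_eq_zero, ← evalMap_componentMap_koszulMap]
  constructor
  · intro h
    rw [h, map_zero, map_zero]
  · intro h
    have h1 := eq_zero_of_evalMap_eq_zero k (S + T) (fun Q => by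
      obtain ⟨x, hx⟩ := exists_componentMap_apply k S (S + T) Fin.succ
        (koszulMap k S T (r + 1) z) Q
      rw [hx]
      exact eq_zero_of_support_wedgeMap Fin.succ_ne_zero x) h
    exact (map_eq_zero_iff _ (componentMap_injective k S (S + T) (Fin.succ_injective r))).1 h1

end Koszul

/-! ### Dimension of the space of symmetric Laurent polynomials -/

section SymmetricFunctions

variable (k : Type*) [Field k] {n : ℕ} (X : Set (Fin n → ℤ)) (p : ℕ)

/-- The Laurent polynomials in `p` groups of variables that are symmetric and whose exponents
lie in `X`. -/
noncomputable def symmetricLaurent : Submodule k (AddMonoidAlgebra k (Fin p → Fin n → ℤ)) where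
  carrier := {G | (∀ σ, permAct σ G = G) ∧ ∀ γ ∈ G.coeff.support, ∀ a, γ a ∈ X}
  add_mem' := by
    rintro f g ⟨hf, hf'⟩ ⟨hg, hg'⟩
    refine ⟨fun σ => by rw [map_add, hf, hg], fun γ hγ => ?_⟩
    rcases mem_support_add hγ with h | h
    exacts [hf' γ h, hg' γ h]
  smul_mem' := by
    rintro c f ⟨hf, hf'⟩
    exact ⟨fun σ => by rw [permAct_smul, hf], fun γ hγ => hf' γ (Finsupp.support_smul hγ)⟩
  zero_mem' := ⟨fun σ => map_zero _, fun γ hγ => by simp at hγ⟩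

variable {k X p}

/-- The unordered tuple underlying a tuple. -/
def unorderedTuple {α : Type*} {p : ℕ} (P : Fin p → α) : Sym α p :=
  ⟨(List.ofFn P : Multiset α), by simp⟩

theorem unorderedTuple_comp_perm {α : Type*} {p : ℕ} (P : Fin p → α) (σ : Equiv.Perm (Fin p)) :
    unorderedTuple (P ∘ σ) = unorderedTuple P :=
  Subtype.ext (Multiset.coe_eq_coe.2 (σ.ofFn_comp_perm P))

theorem exists_perm_of_unorderedTuple_eq {α : Type*} [LinearOrder α] {p : ℕ} {P P' : Fin p → α}
    (h : unorderedTuple P = unorderedTuple P') : ∃ σ : Equiv.Perm (Fin p), P' = P ∘ σ := by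
  have hperm : (List.ofFn P).Perm (List.ofFn P') := Multiset.coe_eq_coe.1 (congrArg Subtype.val h)
  have h1 : P ∘ Tuple.sort P = P' ∘ Tuple.sort P' := by
    apply List.ofFn_injective
    refine List.Perm.eq_of_pairwise' (r := (· ≤ ·)) ?_ ?_
      ((((Tuple.sort P).ofFn_comp_perm P).trans hperm).trans
        ((Tuple.sort P').ofFn_comp_perm P').symm)
    · exact (Tuple.monotone_sort P).sortedLE_ofFn.pairwise
    · exact (Tuple.monotone_sort P').sortedLE_ofFn.pairwise
  refine ⟨(Tuple.sort P) * (Tuple.sort P')⁻¹, ?_⟩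
  funext a
  have := congrFun h1 ((Tuple.sort P')⁻¹ a)
  simpa using this.symm

theorem unorderedTuple_surjective {α : Type*} {p : ℕ} :
    Function.Surjective (unorderedTuple (α := α) (p := p)) := by
  rintro ⟨m, hm⟩
  obtain ⟨l, rfl⟩ := Quotient.exists_rep m
  have hl : l.length = p := hm
  subst hl
  exact ⟨l.get, Subtype.ext (congrArg (fun q : List α => (q : Multiset α)) (List.ofFn_get l))⟩

theorem coeff_comp_perm_of_permAct_eq {G : AddMonoidAlgebra k (Fin p → Fin n → ℤ)}
    (hG : ∀ σ, permAct σ G = G) (γ : Fin p → Fin n → ℤ) (σ : Equiv.Perm (Fin p)) :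
    G.coeff (γ ∘ σ) = G.coeff γ := by
  conv_lhs => rw [← hG σ]
  exact coeff_permAct σ G γ

theorem rank_symmetricLaurent (hX : X.Finite) :
    Module.rank k (symmetricLaurent k X p) = (((p + X.ncard - 1).choose p : ℕ) : Cardinal) := by
  classical
  let _ : LinearOrder X := LinearOrder.lift' (fun P : X => toLex (P : Fin n → ℤ))
    (fun P Q h => Subtype.ext (toLex.injective h))
  have := hX.fintype
  let rep : Sym X p → Fin p → X := Function.surjInv unorderedTuple_surjective
  have hrep : ∀ s, unorderedTuple (rep s) = s := Function.surjInv_eq _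
  let F : symmetricLaurent k X p →ₗ[k] Sym X p → k :=
    { toFun := fun G s => (G : AddMonoidAlgebra k (Fin p → Fin n → ℤ)).coeff fun a => rep s a
      map_add' := fun _ _ => rfl
      map_smul' := fun _ _ => rfl }
  have hinj : Function.Injective F := by
    refine (injective_iff_map_eq_zero _).2 ?_
    rintro ⟨G, hG, hGX⟩ h
    refine Subtype.ext (AddMonoidAlgebra.ext (Finsupp.ext fun γ => ?_))
    by_contra hne
    have hγ := hGX γ (Finsupp.mem_support_iff.2 hne)
    let P : Fin p → X := fun a => ⟨γ a, hγ a⟩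
    obtain ⟨σ, hσ⟩ := exists_perm_of_unorderedTuple_eq (hrep (unorderedTuple P))
    have h1 := congrFun h (unorderedTuple P)
    have h2 : γ = (fun a => (rep (unorderedTuple P) a : Fin n → ℤ)) ∘ σ :=
      funext fun a => congrArg Subtype.val (congrFun hσ a)
    apply hne
    change G.coeff γ = 0
    rw [h2, coeff_comp_perm_of_permAct_eq hG]
    exact h1
  have hsurj : Function.Surjective F := by
    intro c
    -- Summing over tuples instead of permutations gives every monomial of an orbit its coefficient
    -- exactly once, in any characteristic.
    let G : AddMonoidAlgebra k (Fin p → Fin n → ℤ) :=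
      ∑ P : Fin p → X, .single (fun a => (P a : Fin n → ℤ)) (c (unorderedTuple P))
    have hG : G ∈ symmetricLaurent k X p := by
      refine ⟨fun σ => ?_, fun γ hγ a => ?_⟩
      · rw [map_sum]
        refine Fintype.sum_equiv (Equiv.arrowCongr σ.symm (Equiv.refl X)) _ _ fun P => ?_
        have hP : Equiv.arrowCongr σ.symm (Equiv.refl X) P = P ∘ σ := rfl
        rw [permAct_single, hP, unorderedTuple_comp_perm]
        rfl
      · obtain ⟨P, _, hP⟩ := exists_mem_support_of_mem_support_sum hγ
        have : γ = fun a => (P a : Fin n → ℤ) := by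
          simpa using Finsupp.support_single_subset hP
        rw [this]
        exact (P a).2
    refine ⟨⟨G, hG⟩, funext fun s => ?_⟩
    change G.coeff (fun a => (rep s a : Fin n → ℤ)) = c s
    rw [AddMonoidAlgebra.coeff_sum, Finsupp.finsetSum_apply, Finset.sum_eq_single (rep s)]
    · rw [AddMonoidAlgebra.coeff_single, Finsupp.single_eq_same, hrep]
    · intro P _ hP
      rw [AddMonoidAlgebra.coeff_single]
      refine Finsupp.single_eq_of_ne fun h => hP ?_
      exact (funext fun a => Subtype.ext (congrFun h a)).symm
    · simp
  have hfin : Finite (Sym X p) := by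
    exact Finite.of_surjective _ unorderedTuple_surjective
  have := Fintype.ofFinite (Sym X p)
  rw [(LinearEquiv.ofBijective F ⟨hinj, hsurj⟩).rank_eq, rank_fun', ← Nat.card_eq_fintype_card,
    Sym.natCard_sym_eq_choose, Nat.card_coe_set_eq, add_comm]

end SymmetricFunctions

/-! ### The kernel as a space of symmetric Laurent polynomials -/

section KernelDimension

variable {k : Type*} [Field k] {n : ℕ} {S T X : Set (Fin n → ℤ)}

/-- The vector of products of `G` with the signed minors. -/
noncomputable def signedMinorMap {p : ℕ} (τ : Fin (p + 1) ≃ T) :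
    symmetricLaurent k X p →ₗ[k] (T →₀ AddMonoidAlgebra k (Fin p → Fin n → ℤ)) :=
  letI : Finite T := Finite.of_equiv _ τ
  (Finsupp.linearEquivFunOnFinite k (AddMonoidAlgebra k (Fin p → Fin n → ℤ)) T).symm.toLinearMap ∘ₗ
    (LinearMap.pi fun Q => LinearMap.mulLeft k
      (signedMinor k (fun l => (τ l : Fin n → ℤ)) (τ.symm Q))) ∘ₗ
    (symmetricLaurent k X p).subtype

theorem signedMinorMap_apply {p : ℕ} (τ : Fin (p + 1) ≃ T) (G : symmetricLaurent k X p)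
    (l : Fin (p + 1)) : signedMinorMap τ G (τ l) =
      signedMinor k (fun l => (τ l : Fin n → ℤ)) l * (G : AddMonoidAlgebra k _) := by
  have : signedMinorMap τ G (τ l) =
    signedMinor k (fun l => (τ l : Fin n → ℤ)) (τ.symm (τ l)) * (G : AddMonoidAlgebra k _) := rfl
  rw [this, Equiv.symm_apply_apply]

theorem evalMap_eq_sum {p : ℕ} (τ : Fin (p + 1) ≃ T) {I : Type*} [DecidableEq I] (i : I)
    (f : T →₀ AddMonoidAlgebra k (I → Fin n → ℤ)) :
    evalMap k T i f = ∑ l, monomialAt k i (τ l : Fin n → ℤ) * f (τ l) := by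
  have := Fintype.ofEquiv _ τ
  rw [evalMap_apply, Finsupp.sum_fintype _ _ fun _ => mul_zero _]
  exact (Equiv.sum_comp τ fun Q : T => monomialAt k i (Q : Fin n → ℤ) * f Q).symm

theorem rank_ker_koszulMap {p : ℕ} (hp : 2 ≤ p) (τ : Fin (p + 1) ≃ T)
    (hc : ¬ Collinear ℝ (Set.range fun l => latticeToReal (τ l : Fin n → ℤ)))
    (hS : ∀ P, P ∉ S → ∃ w : Module.Dual ℝ (Fin n → ℝ),
      ∀ s ∈ S, w (latticeToReal s) < w (latticeToReal P)) :
    Module.rank k (LinearMap.ker (koszulMap k S T p)) =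
      Module.rank k (symmetricLaurent k (translatesInto T S) p) := by
  obtain ⟨r, rfl⟩ : ∃ r, p = r + 1 := ⟨p - 1, by omega⟩
  have ht : Function.Injective fun l => (τ l : Fin n → ℤ) :=
    Subtype.val_injective.comp τ.injective
  let A := componentMap k S T (id : Fin (r + 1) → Fin (r + 1)) ∘ₗ
    (LinearMap.ker (koszulMap k S T (r + 1))).subtype
  let B := signedMinorMap (k := k) (X := translatesInto T S) τ
  have hA : Function.Injective A :=
    (componentMap_injective k S T Function.injective_id).comp Subtype.val_injective
  have hB : Function.Injective B := by
    refine (injective_iff_map_eq_zero _).2 fun G hG => Subtype.ext ?_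
    have h := signedMinorMap_apply τ G 0
    rw [show signedMinorMap τ G = 0 from hG] at h
    rcases mul_eq_zero.1 h.symm with h1 | h1
    · exact absurd h1 (signedMinor_ne_zero ht 0)
    · exact h1
  -- Both spaces embed into tuples indexed by `T`; it remains to see that their images coincide.
  have hrange : LinearMap.range A = LinearMap.range B := by
    apply le_antisymm
    · rintro _ ⟨⟨z, hz⟩, rfl⟩
      have hz0 := (koszulMap_eq_zero_iff k S T z).1 hz
      set f := componentMap k S T (id : Fin (r + 1) → Fin (r + 1)) z with hf
      have hperm : ∀ σ l, permAct σ (f (τ l)) = signAt k n σ * f (τ l) := by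
        intro σ l
        obtain ⟨x, hx⟩ := exists_componentMap_apply k S T id z (τ l)
        rw [hf, hx, permAct_wedgeMap]
      -- The kernel condition is the equation for `x_0`; swapping `0` and `i` turns it into the one
      -- for `x_i`, up to a sign.
      have hsys : ∀ i : Fin (r + 1), ∑ l, monomialAt k i (τ l : Fin n → ℤ) * f (τ l) = 0 := by
        intro i
        have h := congrArg (permAct (Equiv.swap 0 i)) hz0
        rw [evalMap_eq_sum τ, map_sum, map_zero] at h
        have h1 : ∀ l, permAct (Equiv.swap 0 i) (monomialAt k 0 (τ l : Fin n → ℤ) * f (τ l)) =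
            signAt k n (Equiv.swap 0 i) * (monomialAt k i (τ l : Fin n → ℤ) * f (τ l)) := by
          intro l
          have h2 := permAct_monomialAt (k := k) (Equiv.swap 0 i) i (τ l : Fin n → ℤ)
          rw [Equiv.swap_apply_right] at h2
          rw [map_mul, h2, hperm]
          ring
        rw [Finset.sum_congr rfl fun l _ => h1 l, ← Finset.mul_sum] at h
        exact (mul_eq_zero.1 h).resolve_left (left_ne_zero_of_mul_eq_one (signAt_mul_self _))
      obtain ⟨G, hG⟩ := exists_eq_signedMinor_mul hp ht hc hsys
      have hsym := permAct_eq_of_signedMinor_mul ht hperm hG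
      have hsupp : ∀ γ ∈ G.coeff.support, ∀ a, γ a ∈ translatesInto T S := by
        intro γ hγ a Q hQ
        obtain ⟨m, hm⟩ := τ.surjective ⟨Q, hQ⟩
        have h := mem_of_support_signedMinor_mul (by omega) ht hS (fun l γ hγ i => by
          rw [← hG] at hγ
          obtain ⟨x, hx⟩ := exists_componentMap_apply k S T id z (τ l)
          rw [hf, hx] at hγ
          exact mem_of_support_wedgeMap Function.injective_id x γ hγ i) hγ a m
        rwa [hm] at h
      refine ⟨⟨G, hsym, hsupp⟩, Finsupp.ext fun Q => ?_⟩
      obtain ⟨l, rfl⟩ := τ.surjective Q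
      exact (signedMinorMap_apply τ _ l).trans (hG l).symm
    · rintro _ ⟨G, rfl⟩
      have hmem : B G ∈ LinearMap.range (componentMap k S T (id : Fin (r + 1) → Fin (r + 1))) := by
        refine mem_range_componentMap k S T id fun Q => ?_
        obtain ⟨l, rfl⟩ := τ.surjective Q
        rw [show B G (τ l) = _ from signedMinorMap_apply τ G l]
        exact signedMinor_mul_mem_range l G.2.1 fun γ hγ a m => G.2.2 γ hγ a _ (τ m).2
      obtain ⟨z, hz⟩ := hmem
      refine ⟨⟨z, (koszulMap_eq_zero_iff k S T z).2 ?_⟩, hz⟩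
      rw [hz, evalMap_eq_sum τ]
      have h := sum_monomialAt_mul_signedMinor (k := k) (fun l => (τ l : Fin n → ℤ))
        (0 : Fin (r + 1))
      have h1 : ∀ l, B G (τ l) = signedMinor k (fun l => (τ l : Fin n → ℤ)) l *
        (G : AddMonoidAlgebra k _) := fun l => signedMinorMap_apply τ G l
      simp only [h1, ← mul_assoc]
      rw [← Finset.sum_mul, h, zero_mul]
  rw [(LinearEquiv.ofInjective A hA).rank_eq, (LinearEquiv.ofInjective B hB).rank_eq, hrange]

end KernelDimension

/-! ### Lattice polytopes: finiteness, separation and spanning -/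

section Polytopes

variable {n : ℕ}

theorem IsLatticePolytope.isCompact {Δ : Set (Fin n → ℝ)} (h : IsLatticePolytope Δ) :
    IsCompact Δ := by
  obtain ⟨V, rfl⟩ := h
  exact Set.Finite.isCompact_convexHull ℝ (V.finite_toSet.image _)

theorem IsLatticePolytope.finite_latticePoints {Δ : Set (Fin n → ℝ)} (h : IsLatticePolytope Δ) :
    (latticePoints Δ).Finite := by
  obtain ⟨R, hR⟩ := h.isCompact.isBounded.subset_closedBall 0
  refine (Set.finite_Icc (fun _ : Fin n => -⌈R⌉) (fun _ => ⌈R⌉)).subset fun P hP => ?_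
  have h1 : ∀ i, |(P i : ℝ)| ≤ ⌈R⌉ := by
    intro i
    have h2 := hR hP
    rw [mem_closedBall_zero_iff] at h2
    exact ((norm_le_pi_norm (latticeToReal P) i).trans h2).trans (Int.le_ceil R)
  refine ⟨fun i => ?_, fun i => ?_⟩
  · exact_mod_cast (abs_le.1 (h1 i)).1
  · exact_mod_cast (abs_le.1 (h1 i)).2

theorem IsLatticePolytope.exists_separating {Δ : Set (Fin n → ℝ)} (h : IsLatticePolytope Δ)
    {P : Fin n → ℤ} (hP : P ∉ latticePoints Δ) : ∃ w : Module.Dual ℝ (Fin n → ℝ),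
      ∀ s ∈ latticePoints Δ, w (latticeToReal s) < w (latticeToReal P) := by
  have hconv : Convex ℝ Δ := by
    obtain ⟨V, rfl⟩ := h
    exact convex_convexHull ℝ _
  obtain ⟨f, u, hf, hu⟩ := geometric_hahn_banach_closed_point hconv h.isCompact.isClosed hP
  exact ⟨f, fun s hs => (hf _ hs).trans hu⟩

/-- The generating points are themselves lattice points of `Δ`. Thus dimension greater than `1`
forces `T` to be non-collinear. -/
theorem IsLatticePolytope.vectorSpan_le {Δ : Set (Fin n → ℝ)} (h : IsLatticePolytope Δ) :
    vectorSpan ℝ Δ ≤ vectorSpan ℝ (latticeToReal '' latticePoints Δ) := by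
  obtain ⟨V, rfl⟩ := h
  rw [← direction_affineSpan, affineSpan_convexHull, direction_affineSpan]
  refine vectorSpan_mono ℝ (Set.image_mono fun P hP => ?_)
  exact subset_convexHull ℝ _ ⟨P, hP, rfl⟩

end Polytopes

theorem mainTheorem4 (k : Type*) [Field k] (n : ℕ) (Δ Δ' : Set (Fin n → ℝ))
    (hΔ : IsLatticePolytope Δ) (hΔ' : IsLatticePolytope Δ') (hdim : 1 < polytopeDim Δ)
    (S T X : Set (Fin n → ℤ)) (hT : T = latticePoints Δ) (hS : S = latticePoints Δ')
    (hX : X = translatesInto T S) (p : ℕ) (hp : T.ncard = p + 1) :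
    X.Finite ∧
      Module.rank k (LinearMap.ker (koszulMap k S T p)) =
        (((p + X.ncard - 1).choose p : ℕ) : Cardinal) := by
  have hSfin : S.Finite := hS ▸ hΔ'.finite_latticePoints
  have hTfin : T.Finite := hT ▸ hΔ.finite_latticePoints
  have := hTfin.fintype
  obtain ⟨τ⟩ : Nonempty (Fin (p + 1) ≃ T) :=
    ⟨((Finite.equivFinOfCardEq (by rw [Nat.card_coe_set_eq, hp])).symm)⟩
  have hXfin : X.Finite := by
    refine (hSfin.preimage (f := fun P => P + (τ 0 : Fin n → ℤ))
      (add_left_injective _).injOn).subset fun P hP => ?_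
    rw [hX] at hP
    exact hP _ (τ 0).2
  have hrange : (Set.range fun l => latticeToReal (τ l : Fin n → ℤ)) =
      latticeToReal '' latticePoints Δ := by
    have : (fun l => latticeToReal (τ l : Fin n → ℤ)) = latticeToReal ∘ Subtype.val ∘ τ := rfl
    rw [this, Set.range_comp, Set.range_comp, τ.range_eq_univ, Set.image_univ, Subtype.range_coe,
      hT]
  have hrank : 1 < Module.finrank ℝ
      (vectorSpan ℝ (Set.range fun l => latticeToReal (τ l : Fin n → ℤ))) := by
    rw [hrange]
    exact hdim.trans_le (Submodule.finrank_mono hΔ.vectorSpan_le)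
  -- The span of `p + 1` points has dimension at most `p`.
  have hp2 : 2 ≤ p :=
    hrank.trans_le (finrank_vectorSpan_range_le ℝ _ (Fintype.card_fin (p + 1)))
  refine ⟨hXfin, ?_⟩
  rw [rank_ker_koszulMap hp2 τ (fun hc => absurd (collinear_iff_finrank_le_one.1 hc)
    (not_le.2 hrank)) (fun P hP => ?_), ← hX, rank_symmetricLaurent hXfin]
  subst hS
  exact hΔ'.exists_separating hP
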